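/- Let $\mathsf{Pos}$ be the category of posets and monotone maps, enriched over itself by the pointwise order on hom-sets. A (finitary) signature $\Sigma$ is a family of sets $(\Sigma_n)_{n\in\mathbb N}$. An ordered $\Sigma$-algebra is a poset $A$ together with a monotone map $\sigma_A\colon A^n\to A$ for every $n\in\mathbb N$ and $\sigma\in\Sigma_n$ (where $A^n$ is ordered coordinatewise); homomorphisms are the monotone maps preserving all operations. An inequation $u\le v$ is an ordered pair of $\Sigma$-terms $u,v$ over a fixed countably infinite set of variables; $A$ satisfies it if for every interpretation of the variables in $A$ the value of $u$ is below the value of $v$. A variety of ordered algebras consists of a signature $\Sigma$ and a full subcategory $\mathcal V$ of the category of ordered $\Sigma$-algebras whose objects are exactly the algebras satisfying all members of some set of inequations. Let $U_{\mathcal V}\colon\mathcal V\to\mathsf{Pos}$ be the forgetful functor. Let $\mathsf{Var}(\mathsf{Pos})$ be the category whose objects are the varieties of ordered algebras and whose morphisms $\mathcal V_1\to\mathcal V_2$ are the concrete functors, i.e. the functors $F$ with $U_{\mathcal V_2}F=U_{\mathcal V_1}$ (strictly). A coinserter of an ordered pair of monotone maps $f_0,f_1\colon A\to B$ is a monotone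 map $c\colon B\to C$ with $c f_0\le c f_1$ such that every monotone $u\colon B\to D$ with $uf_0\le uf_1$ factorizes as $u=vc$ for a unique monotone $v\colon C\to D$, and $vc\le v'c$ implies $v\le v'$ for all monotone $v,v'\colon C\to D$. The pair is reflexive if there is a monotone $i\colon B\to A$ with $f_0i=\mathrm{id}_B=f_1i$. A monad on $\mathsf{Pos}$ is strongly finitary if its underlying endofunctor is locally monotone, preserves filtered colimits and preserves coinserters of reflexive pairs. Let $\mathsf{Mnd}_{\mathsf{sf}}(\mathsf{Pos})$ be the category of strongly finitary monads and monad morphisms. **Theorem.** For every variety $\mathcal V$ of ordered algebras the functor $U_{\mathcal V}$ has a left adjoint, and the resulting free-algebra monad $\mathbb T_{\mathcal V}$ on $\mathsf{Pos}$ is strongly finitary. There is an equivalence of categories $$R\colon \mathsf{Var}(\mathsf{Pos})\;\simeq\;\mathsf{Mnd}_{\mathsf{sf}}(\mathsf{Pos})^{\mathrm{op}}$$ with $R(\mathcal V)\cong\mathbb T_{\mathcal V}$ for every variety $\mathcal V$. Moreover, $R$ and these isomorphisms can be chosen so that, after identifying $R(\mathcal V)$ with $\mathbb T_{\mathcal V}$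 along them, $R$ sends a concrete functor $F\colon\mathcal V_1\to\mathcal V_2$ to a monad morphism $\rho\colon\mathbb T_{\mathcal V_2}\to\mathbb T_{\mathcal V_1}$ with $H_\rho K_1=K_2F$. Here $K_i\colon\mathcal V_i\to\mathsf{Pos}^{\mathbb T_{\mathcal V_i}}$ is the comparison functor, and $H_\rho$ sends an Eilenberg–Moore algebra $(A,\alpha)$ to $(A,\alpha\cdot\rho_A)$ and acts as the identity on the underlying monotone maps. -/

import Mathlib

open CategoryTheory CategoryTheory.Limits Opposite

universe u

namespace OrderedAlgebra

/-! ### Endofunctors and monads on the category of posets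

`PartOrd.{u}` is the category of posets and monotone maps. It is enriched over itself by the
pointwise order of monotone maps, which is the order `f.hom ≤ g.hom` of Mathlib's `X →o Y`. -/

/-- `c : B ⟶ C` is a coinserter of the ordered pair `(f₀, f₁)`: it is universal among the monotone
maps `u` with `u ∘ f₀ ≤ u ∘ f₁`, and the factorization `u ↦ v` is monotone. -/
structure IsCoinserter {A B C : PartOrd.{u}} (f₀ f₁ : A ⟶ B) (c : B ⟶ C) : Prop where
  condition : (f₀ ≫ c).hom ≤ (f₁ ≫ c).hom
  existsUnique : ∀ {D : PartOrd.{u}} (w : B ⟶ D), (f₀ ≫ w).hom ≤ (f₁ ≫ w).hom →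
    ∃! v : C ⟶ D, c ≫ v = w
  monotone : ∀ {D : PartOrd.{u}} (v v' : C ⟶ D), (c ≫ v).hom ≤ (c ≫ v').hom → v.hom ≤ v'.hom

/-- The pair `f₀, f₁` is reflexive: the two maps have a common section. -/
def IsReflexivePair {A B : PartOrd.{u}} (f₀ f₁ : A ⟶ B) : Prop :=
  ∃ i : B ⟶ A, i ≫ f₀ = 𝟙 B ∧ i ≫ f₁ = 𝟙 B

/-- Strongly finitary endofunctors of the category of posets: the functor is locally monotone
(that is, it is a functor enriched over posets), it preserves filtered colimits, and it preserves
coinserters of reflexive pairs. -/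
structure IsStronglyFinitary (H : PartOrd.{u} ⥤ PartOrd.{u}) : Prop where
  locallyMonotone : ∀ {X Y : PartOrd.{u}} (f g : X ⟶ Y), f.hom ≤ g.hom →
    (H.map f).hom ≤ (H.map g).hom
  finitary : PreservesFilteredColimits H
  map_isCoinserter : ∀ {A B C : PartOrd.{u}} (f₀ f₁ : A ⟶ B) (c : B ⟶ C),
    IsReflexivePair f₀ f₁ → IsCoinserter f₀ f₁ c → IsCoinserter (H.map f₀) (H.map f₁) (H.map c)

/-- The monads whose endofunctor is strongly finitary. -/
def isStronglyFinitaryMonad : ObjectProperty (Monad PartOrd.{u}) :=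
  fun T => IsStronglyFinitary T.toFunctor

/-- The category of strongly finitary monads on posets and monad morphisms. -/
abbrev StronglyFinitaryMonad : Type (u + 1) :=
  isStronglyFinitaryMonad.{u}.FullSubcategory

/-! ### Ordered algebras -/

/-- A finitary signature: for every `n` a set of `n`-ary operation symbols. -/
def Signature : Type (u + 1) := ℕ → Type u

/-- An ordered `S`-algebra: a poset `A` with a monotone map `Aⁿ → A` for every `n`-ary symbol
(`Aⁿ` has the coordinatewise order). -/
structure OrdAlg (S : Signature.{u}) where
  carrier : PartOrd.{u}
  op : ∀ {n : ℕ}, S n → ((Fin n → carrier) →o carrier)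

/-- Homomorphisms of ordered algebras: monotone maps that preserve the operations. -/
@[ext]
structure OrdAlg.Hom {S : Signature.{u}} (A B : OrdAlg S) where
  map : A.carrier ⟶ B.carrier
  map_op : ∀ {n : ℕ} (σ : S n) (a : Fin n → A.carrier),
    map (A.op σ a) = B.op σ (fun i => map (a i))

/-- The category of ordered `S`-algebras and homomorphisms. -/
instance (S : Signature.{u}) : Category (OrdAlg S) where
  Hom A B := OrdAlg.Hom A B
  id A := { map := 𝟙 A.carrier, map_op := fun _ _ => rfl }
  comp f g :=
    { map := f.map ≫ g.map
      map_op := fun σ a => by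
        change g.map (f.map _) = _
        rw [f.map_op, g.map_op]
        rfl }

/-- The forgetful functor from ordered algebras to posets. -/
def OrdAlg.forget (S : Signature.{u}) : OrdAlg S ⥤ PartOrd.{u} where
  obj A := A.carrier
  map f := f.map
  map_id _ := rfl
  map_comp _ _ := rfl

/-- The terms over the signature `S` in the variables `x₀, x₁, x₂, …`. -/
inductive Term (S : Signature.{u}) : Type u
  | var (k : ℕ) : Term S
  | op {n : ℕ} (σ : S n) (t : Fin n → Term S) : Term S

/-- The value of a term in an ordered algebra under an interpretation of the variables. -/
def Term.eval {S : Signature.{u}} (A : OrdAlg S) (f : ℕ → A.carrier) : Term S → A.carrier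
  | .var k => f k
  | .op σ t => A.op σ (fun i => (t i).eval A f)

/-- The algebra `A` satisfies the inequation `p.1 ≤ p.2`. -/
def OrdAlg.Satisfies {S : Signature.{u}} (A : OrdAlg S) (p : Term S × Term S) : Prop :=
  ∀ f : ℕ → A.carrier, p.1.eval A f ≤ p.2.eval A f

/-! ### Varieties -/

/-- A variety of ordered algebras: a signature together with a class of ordered algebras (a full
subcategory) that can be presented by a set of inequations. -/
structure OrdVariety where
  sig : Signature.{u}
  mem : ObjectProperty (OrdAlg sig)
  presentable : ∃ E : Set (Term sig × Term sig), ∀ A : OrdAlg sig, mem A ↔ ∀ p ∈ E, A.Satisfies p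

namespace OrdVariety

/-- The algebras of the variety, as a full subcategory of all ordered algebras. -/
abbrev Algebras (V : OrdVariety.{u}) : Type (u + 1) := V.mem.FullSubcategory

/-- The forgetful functor from a variety to posets. -/
def forget (V : OrdVariety.{u}) : V.Algebras ⥤ PartOrd.{u} :=
  V.mem.ι ⋙ OrdAlg.forget V.sig

/-- A concrete functor between varieties: it commutes strictly with the forgetful functors.
Hom-sets of a variety are ordered pointwise, and concrete functors are automatically locally
monotone, see `ConcreteFunctor.locallyMonotone`. -/
@[ext]
structure ConcreteFunctor (V W : OrdVariety.{u}) where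
  functor : V.Algebras ⥤ W.Algebras
  comp_forget : functor ⋙ W.forget = V.forget

/-- Concrete functors are functors enriched over posets. -/
theorem ConcreteFunctor.locallyMonotone {V W : OrdVariety.{u}} (F : ConcreteFunctor V W)
    {A B : V.Algebras} (f g : A ⟶ B) (h : (V.forget.map f).hom ≤ (V.forget.map g).hom) :
    (W.forget.map (F.functor.map f)).hom ≤ (W.forget.map (F.functor.map g)).hom := by
  have aux : ∀ G : V.Algebras ⥤ PartOrd.{u}, G = V.forget →
      (G.map f).hom ≤ (G.map g).hom := by
    rintro G rfl
    exact h
  exact aux _ F.comp_forget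

/-- The category of varieties of ordered algebras and concrete functors. -/
instance : Category OrdVariety.{u} where
  Hom V W := ConcreteFunctor V W
  id V := { functor := 𝟭 _, comp_forget := rfl }
  comp F G :=
    { functor := F.functor ⋙ G.functor
      comp_forget := by rw [Functor.assoc, G.comp_forget, F.comp_forget] }
  id_comp _ := rfl
  comp_id _ := rfl
  assoc _ _ _ := rfl

end OrdVariety

end OrderedAlgebra

/-! Free algebras are sets of terms, ordered by the inequations valid throughout the variety. They
lie in the variety because their maps to its members jointly reflect the order.

The free-algebra monad is strongly finitary because filtered colimits and coinserters of reflexive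
pairs of algebras are computed on underlying posets: finitely many elements live at a common stage,
and finitely many chains of inequalities can be traversed one coordinate at a time
(`reflTransGen_pi`). The left adjoint then carries these colimits to the variety, and the forgetful
functor keeps them.

For the equivalence, two facts give full faithfulness. The comparison functor is a strict
isomorphism of categories, with inverse `ofEMFunctor`. Strict lifts of a right adjoint to the
algebras of a monad correspond bijectively to monad morphisms into the monad of the adjunction
(`existsUnique_monadHom`).

For essential surjectivity, a strongly finitary monad `T` yields a variety: the `n`-ary symbols are
the elements of `T` at the discrete poset `n`, and the axioms are all inequations valid in every
`T`-algebra. The canonical monad morphism to `T` is an isomorphism at finite discrete posets. This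
suffices, since a discrete poset is the filtered colimit of its finite subsets and every poset is a
reflexive coinserter of discrete ones (`IsStronglyFinitary.isIso`). -/

namespace OrderedAlgebra

/-! ### Transfer of inequations along homomorphisms -/

section Homomorphisms

variable {S : Signature.{u}}

theorem OrdAlg.Hom.map_eval {A B : OrdAlg S} (h : A ⟶ B) (f : ℕ → A.carrier) (t : Term S) :
    h.map (t.eval A f) = t.eval B (fun k => h.map (f k)) := by
  induction t with
  | var k => rfl
  | op σ t ih =>
    change h.map (A.op σ _) = B.op σ _
    rw [h.map_op]
    congr 1
    funext i
    exact ih i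

theorem OrdAlg.satisfies_of_surjective {A B : OrdAlg S} (h : A ⟶ B)
    (hs : Function.Surjective h.map) {p : Term S × Term S} (hA : A.Satisfies p) :
    B.Satisfies p := by
  intro f
  choose g hg using fun k => hs (f k)
  obtain rfl : (fun k => h.map (g k)) = f := funext hg
  rw [← h.map_eval, ← h.map_eval]
  exact h.map.hom.monotone (hA g)

/-- Covers subalgebras of products without forming the product; the index may therefore range over a
large family, such as all algebras of a variety. -/
theorem OrdAlg.satisfies_of_jointly_reflecting {A : OrdAlg S} {ι : Sort*} {B : ι → OrdAlg S}
    (h : ∀ i, A ⟶ B i) (hr : ∀ x y, (∀ i, (h i).map x ≤ (h i).map y) → x ≤ y)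
    {p : Term S × Term S} (hB : ∀ i, (B i).Satisfies p) : A.Satisfies p := by
  intro f
  refine hr _ _ fun i => ?_
  rw [(h i).map_eval, (h i).map_eval]
  exact hB i _

end Homomorphisms

/-! ### Quotients of preordered algebras -/

section Quotient

variable {S : Signature.{u}} {B : Type u} [Preorder B]

theorem ofAntisymmetrization_toAntisymmetrization_le (b : B) :
    ofAntisymmetrization (· ≤ ·) (toAntisymmetrization (· ≤ ·) b) ≤ b :=
  (toAntisymmetrization_ofAntisymmetrization (· ≤ ·) (toAntisymmetrization (α := B) (· ≤ ·) b)).le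

theorem le_ofAntisymmetrization_toAntisymmetrization (b : B) :
    b ≤ ofAntisymmetrization (· ≤ ·) (toAntisymmetrization (· ≤ ·) b) :=
  (toAntisymmetrization_ofAntisymmetrization (· ≤ ·) (toAntisymmetrization (α := B) (· ≤ ·) b)).ge

/-- The quotient of a preordered set with monotone operations by the induced equivalence. -/
noncomputable def OrdAlg.quotient (o : ∀ {n : ℕ}, S n → (Fin n → B) → B)
    (ho : ∀ {n : ℕ} (σ : S n), Monotone (o σ)) : OrdAlg S where
  carrier := PartOrd.of (Antisymmetrization B (· ≤ ·))
  op σ :=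
    { toFun a := toAntisymmetrization (· ≤ ·) (o σ fun i => ofAntisymmetrization (· ≤ ·) (a i))
      monotone' _ _ hab := toAntisymmetrization_mono
        (ho σ fun i => ofAntisymmetrization_le_ofAntisymmetrization_iff.2 (hab i)) }

/-- The operations of the quotient use chosen representatives; monotonicity makes the choice
immaterial. -/
theorem OrdAlg.quotient_op (o : ∀ {n : ℕ}, S n → (Fin n → B) → B)
    (ho : ∀ {n : ℕ} (σ : S n), Monotone (o σ)) {n : ℕ} (σ : S n) (b : Fin n → B) :
    (OrdAlg.quotient o ho).op σ (fun i => toAntisymmetrization (· ≤ ·) (b i)) =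
      toAntisymmetrization (· ≤ ·) (o σ b) := by
  apply le_antisymm
  · exact toAntisymmetrization_mono
      (ho σ fun i => ofAntisymmetrization_toAntisymmetrization_le (b i))
  · exact toAntisymmetrization_mono
      (ho σ fun i => le_ofAntisymmetrization_toAntisymmetrization (b i))

end Quotient

/-! ### Construction of free algebras -/

section FreeAlgebra

/-- Terms over the signature `S` in variables from `X`. -/
inductive FreeTerm (S : Signature.{u}) (X : Type u) : Type u
  | var (x : X) : FreeTerm S X
  | op {n : ℕ} (σ : S n) (t : Fin n → FreeTerm S X) : FreeTerm S X

/-- The value of a term under an interpretation of the variables. -/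
def FreeTerm.eval {S : Signature.{u}} {X : Type u} (A : OrdAlg S) (f : X → A.carrier) :
    FreeTerm S X → A.carrier
  | .var x => f x
  | .op σ t => A.op σ (fun i => (t i).eval A f)

namespace OrdVariety

variable (V : OrdVariety.{u})

/-- Terms in variables from a poset, preordered by the inequations that hold in the variety. -/
def PreFree (X : PartOrd.{u}) : Type u := FreeTerm V.sig X

instance (X : PartOrd.{u}) : Preorder (V.PreFree X) where
  le t s := ∀ (A : V.Algebras) (f : X ⟶ A.obj.carrier),
    FreeTerm.eval A.obj f t ≤ FreeTerm.eval A.obj f s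
  le_refl _ _ _ := le_rfl
  le_trans _ _ _ h h' A f := (h A f).trans (h' A f)

/-- The free algebra of a variety on a poset, as an ordered algebra. -/
noncomputable def freeOrdAlg (X : PartOrd.{u}) : OrdAlg V.sig :=
  OrdAlg.quotient (B := V.PreFree X) (fun σ t => FreeTerm.op σ t)
    (fun σ _ _ h A f => (A.obj.op σ).monotone fun i => h i A f)

variable {V} in
/-- The homomorphic extension of a monotone map to the free algebra. -/
noncomputable def freeLift {X : PartOrd.{u}} (A : V.Algebras) (f : X ⟶ A.obj.carrier) :
    V.freeOrdAlg X ⟶ A.obj where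
  map := PartOrd.ofHom
    { toFun t := FreeTerm.eval A.obj f (ofAntisymmetrization (α := V.PreFree X) (· ≤ ·) t)
      monotone' _ _ h := ofAntisymmetrization_le_ofAntisymmetrization_iff.2 h A f }
  map_op σ a := by
    refine le_antisymm
      (ofAntisymmetrization_toAntisymmetrization_le (B := V.PreFree X) _ A f)
      (le_ofAntisymmetrization_toAntisymmetrization (B := V.PreFree X)
        (FreeTerm.op σ fun i => ofAntisymmetrization (α := V.PreFree X) (· ≤ ·) (a i)) A f)

theorem freeLift_mk {X : PartOrd.{u}} (A : V.Algebras) (f : X ⟶ A.obj.carrier)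
    (t : V.PreFree X) :
    (freeLift A f).map (toAntisymmetrization (· ≤ ·) t) = FreeTerm.eval A.obj f t :=
  le_antisymm (ofAntisymmetrization_toAntisymmetrization_le t A f)
    (le_ofAntisymmetrization_toAntisymmetrization t A f)

variable {V} in
theorem mem_of_jointly_reflecting {A : OrdAlg V.sig} {ι : Sort*} {B : ι → V.Algebras}
    (h : ∀ i, A ⟶ (B i).obj) (hr : ∀ x y, (∀ i, (h i).map x ≤ (h i).map y) → x ≤ y) :
    V.mem A := by
  obtain ⟨E, hE⟩ := V.presentable
  exact (hE A).2 fun p hp =>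
    OrdAlg.satisfies_of_jointly_reflecting h hr fun i => (hE _).1 (B i).property p hp

variable {V} in
theorem mem_of_surjective {A : V.Algebras} {B : OrdAlg V.sig} (h : A.obj ⟶ B)
    (hs : Function.Surjective h.map) : V.mem B := by
  obtain ⟨E, hE⟩ := V.presentable
  exact (hE B).2 fun p hp => OrdAlg.satisfies_of_surjective h hs ((hE _).1 A.property p hp)

/-- The free algebra of a variety on a poset. -/
noncomputable def freeAlg (X : PartOrd.{u}) : V.Algebras where
  obj := V.freeOrdAlg X
  -- Joint reflection by all homomorphic extensions is the definition of the preorder on terms.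
  property := mem_of_jointly_reflecting
    (ι := (A : V.Algebras) × (X ⟶ A.obj.carrier)) (B := fun i => i.1)
    (fun i => freeLift i.1 i.2)
    (fun _ _ h => ofAntisymmetrization_le_ofAntisymmetrization_iff.1 fun A f => h ⟨A, f⟩)

/-- The inclusion of the generators into the free algebra. -/
noncomputable def freeUnit (X : PartOrd.{u}) : X ⟶ (V.freeAlg X).obj.carrier :=
  PartOrd.ofHom
    { toFun x := toAntisymmetrization (α := V.PreFree X) (· ≤ ·) (FreeTerm.var x)
      monotone' _ _ h := toAntisymmetrization_mono fun _ f => f.hom.monotone h }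

variable {V} in
theorem freeAlg_hom_ext {X : PartOrd.{u}} {A : V.Algebras} (g h : V.freeAlg X ⟶ A)
    (w : ∀ x, g.hom.map (V.freeUnit X x) = h.hom.map (V.freeUnit X x)) : g = h := by
  have key : ∀ t : FreeTerm V.sig X,
      g.hom.map (toAntisymmetrization (α := V.PreFree X) (· ≤ ·) t) =
        h.hom.map (toAntisymmetrization (α := V.PreFree X) (· ≤ ·) t) := by
    intro t
    induction t with
    | var x => exact w x
    | op σ t ih =>
      have e := OrdAlg.quotient_op (B := V.PreFree X) (fun σ t => FreeTerm.op σ t)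
        (fun σ _ _ h A f => (A.obj.op σ).monotone fun i => h i A f) σ t
      refine (congrArg g.hom.map e.symm).trans (Eq.trans ?_ (congrArg h.hom.map e))
      refine (g.hom.map_op σ _).trans (Eq.trans ?_ (h.hom.map_op σ _).symm)
      congr 1
      funext i
      exact ih i
  apply ObjectProperty.hom_ext
  apply OrdAlg.Hom.ext
  apply PartOrd.ext
  intro x
  exact Antisymmetrization.ind (α := V.PreFree X) (· ≤ ·)
    (p := fun x => g.hom.map x = h.hom.map x) key x

theorem forget_isRightAdjoint : V.forget.IsRightAdjoint :=
  (Adjunction.adjunctionOfEquivLeft (G := V.forget) (F_obj := V.freeAlg)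
    (fun X A =>
      { toFun h := V.freeUnit X ≫ h.hom.map
        invFun f := ObjectProperty.homMk (freeLift A f)
        left_inv _ := freeAlg_hom_ext _ _ fun x => V.freeLift_mk A _ (FreeTerm.var x)
        right_inv _ := PartOrd.ext fun x => V.freeLift_mk A _ (FreeTerm.var x) })
    (fun _ _ _ _ _ => rfl)).isRightAdjoint

end OrdVariety

end FreeAlgebra

/-! ### Free algebras for an arbitrary left adjoint -/

namespace OrdVariety

variable {V : OrdVariety.{u}} {L : PartOrd.{u} ⥤ V.Algebras} (adj : L ⊣ V.forget)

/-- The generators of a free algebra. -/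
def gen {X : PartOrd.{u}} : X → (L.obj X).obj.carrier := (adj.unit.app X)

/-- The homomorphic extension of a monotone map to a free algebra. -/
def lift {X : PartOrd.{u}} {A : V.Algebras} (f : X ⟶ A.obj.carrier) : L.obj X ⟶ A :=
  (adj.homEquiv X A).symm f

theorem unit_lift {X : PartOrd.{u}} {A : V.Algebras} (f : X ⟶ A.obj.carrier) :
    adj.unit.app X ≫ (lift adj f).hom.map = f :=
  (adj.homEquiv_unit X A _).symm.trans ((adj.homEquiv X A).apply_symm_apply f)

theorem lift_gen {X : PartOrd.{u}} {A : V.Algebras} (f : X ⟶ A.obj.carrier) (x : X) :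
    (lift adj f).hom.map (gen adj x) = f x :=
  ConcreteCategory.congr_hom (unit_lift adj f) x

include adj in
theorem hom_ext_gen {X : PartOrd.{u}} {A : V.Algebras} {g h : L.obj X ⟶ A}
    (w : ∀ x, g.hom.map (gen adj x) = h.hom.map (gen adj x)) : g = h := by
  apply (adj.homEquiv X A).injective
  rw [adj.homEquiv_unit, adj.homEquiv_unit]
  exact PartOrd.ext w

include adj in
-- The elements with property `P` form a subalgebra, which lies in the variety. Extending the
-- generators to it and including back gives an endomorphism that fixes the generators, hence the
-- identity. This replaces induction on terms, as `L` need not be built from terms.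
theorem gen_induction {X : PartOrd.{u}} {P : (L.obj X).obj.carrier → Prop}
    (hgen : ∀ x, P (gen adj x))
    (hop : ∀ {n : ℕ} (σ : V.sig n) (a : Fin n → (L.obj X).obj.carrier),
      (∀ i, P (a i)) → P ((L.obj X).obj.op σ a)) (y : (L.obj X).obj.carrier) : P y := by
  let S₀ : OrdAlg V.sig :=
    { carrier := PartOrd.of {y // P y}
      op σ :=
        { toFun a := ⟨(L.obj X).obj.op σ fun i => (a i).1, hop σ _ fun i => (a i).2⟩
          monotone' _ _ h := ((L.obj X).obj.op σ).monotone fun i => h i } }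
  let incl : S₀ ⟶ (L.obj X).obj :=
    { map := PartOrd.ofHom ⟨Subtype.val, fun _ _ h => h⟩
      map_op _ _ := rfl }
  let S : V.Algebras :=
    ⟨S₀, mem_of_jointly_reflecting (ι := Unit) (B := fun _ => L.obj X) (fun _ => incl)
      fun _ _ h => h ()⟩
  let f : X ⟶ S.obj.carrier :=
    PartOrd.ofHom ⟨fun x => ⟨gen adj x, hgen x⟩, fun _ _ h => (adj.unit.app X).hom.monotone h⟩
  let g : L.obj X ⟶ S := lift adj f
  let j : S ⟶ L.obj X := ObjectProperty.homMk incl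
  have hj : g ≫ j = 𝟙 _ := hom_ext_gen adj fun x =>
    congrArg Subtype.val (lift_gen adj f x)
  have hy : incl.map (g.hom.map y) = y :=
    ConcreteCategory.congr_hom (congrArg (fun k => V.forget.map k) hj) y
  exact hy ▸ (g.hom.map y).2

include adj in
theorem hom_le_of_gen {X : PartOrd.{u}} {A : V.Algebras} {g h : L.obj X ⟶ A}
    (w : ∀ x, g.hom.map (gen adj x) ≤ h.hom.map (gen adj x)) (y : (L.obj X).obj.carrier) :
    g.hom.map y ≤ h.hom.map y := by
  refine gen_induction adj (P := fun y => g.hom.map y ≤ h.hom.map y) w (fun σ a ih => ?_) y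
  rw [g.hom.map_op, h.hom.map_op]
  exact (A.obj.op σ).monotone ih

theorem map_gen {X Y : PartOrd.{u}} (f : X ⟶ Y) (x : X) :
    (L.map f).hom.map (gen adj x) = gen adj (f x) :=
  (ConcreteCategory.congr_hom (adj.unit.naturality f) x).symm

end OrdVariety

/-- A monotone map out of a preorder descends to the quotient poset. -/
def antisymmetrizationDesc {B D : Type u} [Preorder B] [PartialOrder D] (f : B →o D) :
    Antisymmetrization B (· ≤ ·) →o D where
  toFun q := Quotient.liftOn' q f fun _ _ h =>
    le_antisymm (f.monotone h.1) (f.monotone h.2)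
  monotone' p q := by
    induction p using Quotient.inductionOn'
    induction q using Quotient.inductionOn'
    exact fun h => f.monotone h

/-! ### Filtered colimits of posets -/

section Filtered

variable {J : Type u} [SmallCategory J] [IsFiltered J]

theorem exists_upper_bound {n : ℕ} (j : Fin n → J) : ∃ k, Nonempty (∀ i, j i ⟶ k) := by
  classical
  obtain ⟨k, hk⟩ := IsFiltered.sup_objs_exists (Finset.univ.image j)
  exact ⟨k, ⟨fun i => (hk (Finset.mem_image_of_mem j (Finset.mem_univ i))).some⟩⟩

/-- Finitely many conditions that hold eventually, and persist, hold at one common stage. -/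
theorem exists_forall_hom {X : J} {n : ℕ} (P : Fin n → ∀ ⦃Y : J⦄, (X ⟶ Y) → Prop)
    (hP : ∀ i ⦃Y Z : J⦄ (f : X ⟶ Y) (g : Y ⟶ Z), P i f → P i (f ≫ g))
    (h : ∀ i, ∃ (Y : J) (f : X ⟶ Y), P i f) : ∃ (Y : J) (f : X ⟶ Y), ∀ i, P i f := by
  induction n with
  | zero => exact ⟨X, 𝟙 X, fun i => i.elim0⟩
  | succ n ih =>
    obtain ⟨Y, f, hf⟩ := ih (fun i => P i.succ) (fun i => hP i.succ) fun i => h i.succ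
    obtain ⟨Z, g, hg⟩ := h 0
    obtain ⟨W, s, t, hst⟩ := IsFiltered.span f g
    refine ⟨W, f ≫ s, fun i => ?_⟩
    induction i using Fin.cases with
    | zero => exact hst ▸ hP 0 g t hg
    | succ i => exact hP _ f s (hf i)

/-- The elements of the objects of a filtered diagram of posets. -/
def PreColimit (D : J ⥤ PartOrd.{u}) : Type u := Σ j, D.obj j

/-- An inequality witnessed at `k` becomes visible beyond any prescribed stage `N`: first the two
paths from `j` are merged, then those from `j'` are coequalized. -/
theorem PreColimit.exists_hom_le (D : J ⥤ PartOrd.{u}) {j j' k N : J} {x : D.obj j}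
    {y : D.obj j'} (f : j ⟶ k) (g : j' ⟶ k) (h : D.map f x ≤ D.map g y) (s : j ⟶ N)
    (t : j' ⟶ N) : ∃ (M : J) (e : N ⟶ M), D.map (s ≫ e) x ≤ D.map (t ≫ e) y := by
  obtain ⟨M, a, b, hab⟩ := IsFiltered.span s f
  refine ⟨IsFiltered.coeq (t ≫ a) (g ≫ b), a ≫ IsFiltered.coeqHom (t ≫ a) (g ≫ b), ?_⟩
  rw [← Category.assoc, ← Category.assoc, hab, IsFiltered.coeq_condition (t ≫ a) (g ≫ b)]
  simp only [Functor.map_comp, PartOrd.comp_apply]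
  exact (D.map _).hom.monotone ((D.map b).hom.monotone h)

instance (D : J ⥤ PartOrd.{u}) : Preorder (PreColimit D) where
  le p q := ∃ (k : J) (f : p.1 ⟶ k) (g : q.1 ⟶ k), D.map f p.2 ≤ D.map g q.2
  le_refl p := ⟨p.1, 𝟙 _, 𝟙 _, le_rfl⟩
  le_trans p q r := by
    rintro ⟨k, f, g, h⟩ ⟨l, f', g', h'⟩
    obtain ⟨m, a, b, hab⟩ := IsFiltered.span g f'
    refine ⟨m, f ≫ a, g' ≫ b, ?_⟩
    calc D.map (f ≫ a) p.2 = D.map a (D.map f p.2) := by simp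
      _ ≤ D.map a (D.map g q.2) := (D.map a).hom.monotone h
      _ = D.map b (D.map f' q.2) := by
        rw [← PartOrd.comp_apply, ← PartOrd.comp_apply, ← D.map_comp, ← D.map_comp, hab]
      _ ≤ D.map b (D.map g' r.2) := (D.map b).hom.monotone h'
      _ = D.map (g' ≫ b) r.2 := by simp

/-- The colimit of a filtered diagram of posets. -/
def filteredColimitCocone (D : J ⥤ PartOrd.{u}) : Cocone D where
  pt := PartOrd.of (Antisymmetrization (PreColimit D) (· ≤ ·))
  ι :=
    { app j := PartOrd.ofHom
        { toFun x := toAntisymmetrization (α := PreColimit D) (· ≤ ·) ⟨j, x⟩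
          monotone' _ _ h := toAntisymmetrization_mono
            ⟨j, 𝟙 _, 𝟙 _, (D.map (𝟙 j)).hom.monotone h⟩ }
      naturality _ k f := PartOrd.ext fun x => le_antisymm
        (toAntisymmetrization_mono (α := PreColimit D) ⟨k, 𝟙 _, f,
          (ConcreteCategory.congr_hom (D.map_id k) (D.map f x)).le⟩)
        (toAntisymmetrization_mono (α := PreColimit D) ⟨k, f, 𝟙 _,
          (ConcreteCategory.congr_hom (D.map_id k) (D.map f x)).ge⟩) }

/-- The factorization of a cocone through the colimit of a filtered diagram of posets. -/
def filteredColimitDesc (D : J ⥤ PartOrd.{u}) (s : Cocone D) :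
    (filteredColimitCocone D).pt ⟶ s.pt :=
  PartOrd.ofHom (antisymmetrizationDesc (B := PreColimit D)
    { toFun p := s.ι.app p.1 p.2
      monotone' p q := by
        rintro ⟨k, f, g, h⟩
        have := (s.ι.app k).hom.monotone h
        change s.ι.app k (D.map f p.2) ≤ s.ι.app k (D.map g q.2) at this
        rwa [← PartOrd.comp_apply, ← PartOrd.comp_apply, s.w, s.w] at this })

theorem filteredColimit_exists_rep (D : J ⥤ PartOrd.{u}) {n : ℕ}
    (a : Fin n → (filteredColimitCocone D).pt) :
    ∃ (k : J) (b : Fin n → D.obj k), a = fun i => (filteredColimitCocone D).ι.app k (b i) := by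
  have h : ∀ i, ∃ p : PreColimit D, toAntisymmetrization (· ≤ ·) p = a i :=
    fun i => Antisymmetrization.ind (α := PreColimit D) (· ≤ ·)
      (p := fun x => ∃ p, toAntisymmetrization (· ≤ ·) p = x) (fun p => ⟨p, rfl⟩) (a i)
  choose p hp using h
  obtain ⟨k, ⟨f⟩⟩ := exists_upper_bound fun i => (p i).1
  refine ⟨k, fun i => D.map (f i) (p i).2, funext fun i => ?_⟩
  rw [← PartOrd.comp_apply, Cocone.w]
  exact (hp i).symm

/-- The cocone `filteredColimitCocone D` is a colimit. -/
def filteredColimitIsColimit (D : J ⥤ PartOrd.{u}) : IsColimit (filteredColimitCocone D) where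
  desc := filteredColimitDesc D
  fac _ _ := rfl
  uniq s m hm := PartOrd.ext fun x => by
    obtain ⟨k, b, hb⟩ := filteredColimit_exists_rep D (fun _ : Fin 1 => x)
    obtain rfl : x = _ := congrFun hb 0
    exact ConcreteCategory.congr_hom (hm k) (b 0)

end Filtered

/-- A term contains finitely many variables. The bound is uniform in the algebra, so an
interpretation in a colimit can be replaced by one at a single stage. -/
theorem Term.exists_bound {S : Signature.{u}} (t : Term S) : ∃ N : ℕ, ∀ (A : OrdAlg S)
    (f g : ℕ → A.carrier), (∀ k < N, f k = g k) → t.eval A f = t.eval A g := by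
  induction t with
  | var k => exact ⟨k + 1, fun A f g h => h k k.lt_succ_self⟩
  | op σ t ih =>
    choose N hN using ih
    refine ⟨Finset.univ.sup N, fun A f g h => ?_⟩
    change A.op σ _ = A.op σ _
    congr 1
    funext i
    exact hN i A f g fun k hk => h k (hk.trans_le (Finset.le_sup (Finset.mem_univ i)))

/-! ### Filtered colimits of algebras -/

namespace OrdVariety

variable {V : OrdVariety.{u}} {J : Type u} [SmallCategory J] (K : J ⥤ V.Algebras)

theorem map_map_op {i j : J} (f : i ⟶ j) {n : ℕ} (σ : V.sig n)
    (a : Fin n → (K.obj i).obj.carrier) :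
    (K ⋙ V.forget).map f ((K.obj i).obj.op σ a) =
      (K.obj j).obj.op σ fun l => (K ⋙ V.forget).map f (a l) :=
  (K.map f).hom.map_op σ a

variable [IsFiltered J]

/-- The operations on the elements of a filtered diagram of algebras. -/
noncomputable def preColimitOp {n : ℕ} (σ : V.sig n) (a : Fin n → PreColimit (K ⋙ V.forget)) :
    PreColimit (K ⋙ V.forget) :=
  ⟨(exists_upper_bound fun i => (a i).1).choose,
    (K.obj _).obj.op σ fun i => (K ⋙ V.forget).map
      ((exists_upper_bound fun i => (a i).1).choose_spec.some i) (a i).2⟩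

/-- Forgets which upper bound was chosen: only the existence of some stage and maps to it matters
later. -/
theorem exists_preColimitOp_eq {n : ℕ} (σ : V.sig n)
    (a : Fin n → PreColimit (K ⋙ V.forget)) : ∃ (l : J) (s : ∀ i, (a i).1 ⟶ l),
    preColimitOp K σ a =
      ⟨l, (K.obj l).obj.op σ fun i => (K ⋙ V.forget).map (s i) (a i).2⟩ :=
  ⟨_, _, rfl⟩

theorem preColimitOp_monotone {n : ℕ} (σ : V.sig n) : Monotone (preColimitOp K σ) := by
  intro a b hab
  obtain ⟨l, s, hs⟩ := exists_preColimitOp_eq K σ a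
  obtain ⟨m, t, ht⟩ := exists_preColimitOp_eq K σ b
  rw [hs, ht]
  obtain ⟨M, e, he⟩ := exists_forall_hom (X := IsFiltered.max l m)
    (fun i M e => (K ⋙ V.forget).map (s i ≫ IsFiltered.leftToMax l m ≫ e) (a i).2 ≤
      (K ⋙ V.forget).map (t i ≫ IsFiltered.rightToMax l m ≫ e) (b i).2)
    (fun i Y Z f g h => by
      have := ((K ⋙ V.forget).map g).hom.monotone h
      simpa using this)
    (fun i => by
      obtain ⟨k, f, g, h⟩ := hab i
      simpa using PreColimit.exists_hom_le (K ⋙ V.forget) f g h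
        (s i ≫ IsFiltered.leftToMax l m) (t i ≫ IsFiltered.rightToMax l m))
  refine ⟨M, IsFiltered.leftToMax l m ≫ e, IsFiltered.rightToMax l m ≫ e, ?_⟩
  refine (map_map_op K _ σ _).trans_le (le_trans ?_ (map_map_op K _ σ _).ge)
  refine ((K.obj M).obj.op σ).monotone fun i => ?_
  have h := he i
  rw [Functor.map_comp _ (s i), Functor.map_comp _ (t i)] at h
  exact h

/-- The ordered algebra on the colimit of a filtered diagram of algebras. -/
noncomputable def filteredColimitOrdAlg : OrdAlg V.sig :=
  OrdAlg.quotient (B := PreColimit (K ⋙ V.forget)) (preColimitOp K) (preColimitOp_monotone K)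

/-- The homomorphisms of the colimit cocone. -/
noncomputable def filteredColimitι (j : J) : (K.obj j).obj ⟶ filteredColimitOrdAlg K where
  map := (filteredColimitCocone (K ⋙ V.forget)).ι.app j
  map_op {n} σ a := by
    refine Eq.trans ?_ (OrdAlg.quotient_op (B := PreColimit (K ⋙ V.forget)) (preColimitOp K)
      (preColimitOp_monotone K) σ fun i => ⟨j, a i⟩).symm
    -- The operation was computed at a chosen stage, reached from `j` by possibly different maps for
    -- different arguments; going further along the diagram makes them all agree.
    have key : ∃ (M : J) (f : j ⟶ M)
        (g : (preColimitOp K σ fun i => ⟨j, a i⟩).1 ⟶ M), (K ⋙ V.forget).map f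
          ((K.obj j).obj.op σ a) = (K ⋙ V.forget).map g (preColimitOp K σ fun i => ⟨j, a i⟩).2 := by
      obtain ⟨l, s, hs⟩ := exists_preColimitOp_eq K σ fun i => ⟨j, a i⟩
      rw [hs]
      obtain ⟨M, e, he⟩ := exists_forall_hom (X := IsFiltered.max l j)
        (fun i M e => s i ≫ IsFiltered.leftToMax l j ≫ e = IsFiltered.rightToMax l j ≫ e)
        (fun i Y Z f g h => by simpa using congrArg (· ≫ g) h)
        (fun i => ⟨_, IsFiltered.coeqHom (s i ≫ IsFiltered.leftToMax l j)
          (IsFiltered.rightToMax l j), by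
            simpa using IsFiltered.coeq_condition (s i ≫ IsFiltered.leftToMax l j)
              (IsFiltered.rightToMax l j)⟩)
      refine ⟨M, IsFiltered.rightToMax l j ≫ e, IsFiltered.leftToMax l j ≫ e, ?_⟩
      refine (map_map_op K _ σ a).trans (Eq.trans ?_ (map_map_op K _ σ _).symm)
      congr 1
      funext i
      rw [← he i, Functor.map_comp]
      rfl
    obtain ⟨M, f, g, h⟩ := key
    exact le_antisymm
      (toAntisymmetrization_mono (α := PreColimit (K ⋙ V.forget)) ⟨M, f, g, h.le⟩)
      (toAntisymmetrization_mono (α := PreColimit (K ⋙ V.forget)) ⟨M, g, f, h.ge⟩)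

theorem filteredColimit_mem : V.mem (filteredColimitOrdAlg K) := by
  obtain ⟨E, hE⟩ := V.presentable
  refine (hE _).2 fun p hp f => ?_
  obtain ⟨N₁, h₁⟩ := p.1.exists_bound
  obtain ⟨N₂, h₂⟩ := p.2.exists_bound
  obtain ⟨k, b, hb⟩ := filteredColimit_exists_rep (K ⋙ V.forget)
    (fun i : Fin (max N₁ N₂ + 1) => f i)
  -- Variables beyond the bound do not matter and are truncated to the last index; the `+ 1` keeps
  -- the index set nonempty.
  let g : ℕ → (K.obj k).obj.carrier := fun m => b ⟨min m (max N₁ N₂), by omega⟩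
  have hg : ∀ m < max N₁ N₂, f m = (filteredColimitι K k).map (g m) := fun m hm => by
    refine Eq.trans ?_ (congrFun hb _)
    simp [hm.le]
  rw [h₁ _ f _ fun m hm => hg m (lt_max_of_lt_left hm),
    h₂ _ f _ fun m hm => hg m (lt_max_of_lt_right hm),
    ← (filteredColimitι K k).map_eval, ← (filteredColimitι K k).map_eval]
  exact (filteredColimitι K k).map.hom.monotone ((hE _).1 (K.obj k).property p hp g)

/-- The colimit cocone of a filtered diagram of algebras. -/
noncomputable def filteredCocone : Cocone K where
  pt := ⟨filteredColimitOrdAlg K, filteredColimit_mem K⟩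
  ι :=
    { app j := ObjectProperty.homMk (filteredColimitι K j)
      naturality _ _ f := ObjectProperty.hom_ext _ (OrdAlg.Hom.ext
        ((filteredColimitCocone (K ⋙ V.forget)).ι.naturality f)) }

/-- The cocone `filteredCocone K` is a colimit. -/
noncomputable def filteredCoconeIsColimit : IsColimit (filteredCocone K) where
  desc s := ObjectProperty.homMk
    { map := filteredColimitDesc (K ⋙ V.forget) (V.forget.mapCocone s)
      map_op {n} σ a := by
        obtain ⟨k, b, rfl⟩ := filteredColimit_exists_rep (K ⋙ V.forget) a
        refine (congrArg (filteredColimitDesc (K ⋙ V.forget) (V.forget.mapCocone s))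
          ((filteredColimitι K k).map_op σ b).symm).trans ?_
        exact (s.ι.app k).hom.map_op σ b }
  fac _ _ := rfl
  uniq s m hm := ObjectProperty.hom_ext _ (OrdAlg.Hom.ext
    ((filteredColimitIsColimit (K ⋙ V.forget)).uniq (V.forget.mapCocone s) m.hom.map
      fun j => congrArg (fun h => h.hom.map) (hm j)))

instance forget_preservesFilteredColimits : PreservesFilteredColimits V.forget where
  preserves_filtered_colimits _ _ _ :=
    { preservesColimit {K} := preservesColimit_of_preserves_colimit_cocone
        (filteredCoconeIsColimit K) (filteredColimitIsColimit (K ⋙ V.forget)) }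

theorem toMonad_preservesFilteredColimits {L : PartOrd.{u} ⥤ V.Algebras} (adj : L ⊣ V.forget) :
    PreservesFilteredColimits adj.toMonad.toFunctor :=
  have := adj.leftAdjoint_preservesColimits
  inferInstanceAs (PreservesFilteredColimits (L ⋙ V.forget))

end OrdVariety

/-- The head is moved first, then the tail; reflexivity of `r` lets the idle coordinates stand
still. This commutes finite powers with reflexive coinserters. -/
theorem reflTransGen_pi {α : Type u} {r : α → α → Prop} (hr : ∀ x, r x x) {n : ℕ}
    {a b : Fin n → α} (h : ∀ i, Relation.ReflTransGen r (a i) (b i)) :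
    Relation.ReflTransGen (fun a b : Fin n → α => ∀ i, r (a i) (b i)) a b := by
  induction n with
  | zero => rw [Subsingleton.elim a b]
  | succ n ih =>
    rw [← Fin.cons_self_tail a, ← Fin.cons_self_tail b]
    refine Relation.ReflTransGen.trans (b := Fin.cons (b 0) (Fin.tail a)) ?_ ?_
    · refine Relation.ReflTransGen.lift (fun x => Fin.cons x (Fin.tail a)) ?_ _ _ (h 0)
      intro x y hxy i
      induction i using Fin.cases with
      | zero => simpa using hxy
      | succ i => simpa using hr _
    · refine Relation.ReflTransGen.lift (fun x => Fin.cons (b 0) x) ?_ (Fin.tail a) (Fin.tail b)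
        (ih fun i => h i.succ)
      intro x y hxy i
      induction i using Fin.cases with
      | zero => simpa using hr _
      | succ i => simpa using hxy i

/-! ### Coinserters of reflexive pairs of posets -/

section Coinserter

variable {A B C : PartOrd.{u}} {f₀ f₁ : A ⟶ B} {c : B ⟶ C}

theorem IsCoinserter.hom_ext (h : IsCoinserter f₀ f₁ c) {D : PartOrd.{u}} {v v' : C ⟶ D}
    (e : c ≫ v = c ≫ v') : v = v' :=
  PartOrd.hom_ext (le_antisymm (h.monotone v v' (e ▸ le_rfl)) (h.monotone v' v (e ▸ le_rfl)))

theorem IsCoinserter.of_iso (h : IsCoinserter f₀ f₁ c) {C' : PartOrd.{u}} (e : C ≅ C')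
    {c' : B ⟶ C'} (hc : c ≫ e.hom = c') : IsCoinserter f₀ f₁ c' where
  condition a := by
    subst hc
    exact e.hom.hom.monotone (h.condition a)
  existsUnique w hw := by
    subst hc
    obtain ⟨v, hv, -⟩ := h.existsUnique w hw
    exact ⟨e.inv ≫ v, by simpa using hv, fun v' hv' => by
      rw [Iso.eq_inv_comp]
      exact h.hom_ext (by simpa [hv] using hv')⟩
  monotone v v' hv x := by
    subst hc
    have := h.monotone (e.hom ≫ v) (e.hom ≫ v') hv (e.inv x)
    simpa using this

variable (f₀ f₁)

/-- One step in the order that a coinserter of a reflexive pair induces. -/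
def InserterRel (b b' : B) : Prop := ∃ a, b ≤ f₀ a ∧ f₁ a ≤ b'

/-- The object `B` with the preorder that the coinserter of a reflexive pair induces. -/
def PreCoinserter (_ : A ⟶ B) (_ : A ⟶ B) : Type u := B

instance : Preorder (PreCoinserter f₀ f₁) where
  le := Relation.ReflTransGen (InserterRel f₀ f₁)
  le_refl _ := .refl
  le_trans _ _ _ := .trans

variable {f₀ f₁}

/-- The witness comes from the common section. Thus one-step chains already contain the order of
`B`, and the relation is reflexive. -/
theorem IsReflexivePair.inserterRel_of_le (h : IsReflexivePair f₀ f₁) {b b' : B} (hb : b ≤ b') :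
    InserterRel f₀ f₁ b b' := by
  obtain ⟨i, h₀, h₁⟩ := h
  exact ⟨i b, (ConcreteCategory.congr_hom h₀ b).ge,
    (ConcreteCategory.congr_hom h₁ b).le.trans hb⟩

/-- The coinserter of a reflexive pair. -/
def coinserterProj (h : IsReflexivePair f₀ f₁) :
    B ⟶ PartOrd.of (Antisymmetrization (PreCoinserter f₀ f₁) (· ≤ ·)) :=
  PartOrd.ofHom
    { toFun b := toAntisymmetrization (α := PreCoinserter f₀ f₁) (· ≤ ·) b
      monotone' _ _ hb := toAntisymmetrization_mono (α := PreCoinserter f₀ f₁)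
        (.single (h.inserterRel_of_le hb)) }

theorem coinserterProj_surjective (h : IsReflexivePair f₀ f₁) :
    Function.Surjective (coinserterProj h) :=
  fun x => Antisymmetrization.ind (α := PreCoinserter f₀ f₁) (· ≤ ·)
    (p := fun x => ∃ b, coinserterProj h b = x) (fun b => ⟨b, rfl⟩) x

theorem coinserterProj_isCoinserter (h : IsReflexivePair f₀ f₁) :
    IsCoinserter f₀ f₁ (coinserterProj h) where
  condition a := toAntisymmetrization_mono (α := PreCoinserter f₀ f₁)
    (.single ⟨a, le_rfl, le_rfl⟩)
  existsUnique {D} w hw := by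
    refine ⟨PartOrd.ofHom (antisymmetrizationDesc (B := PreCoinserter f₀ f₁)
      ⟨fun b => w b, ?_⟩), rfl, fun v hv => PartOrd.ext fun x => ?_⟩
    · intro b b' hb
      change Relation.ReflTransGen (InserterRel f₀ f₁) b b' at hb
      induction hb with
      | refl => exact le_rfl
      | tail _ hr ih =>
        obtain ⟨a, h₀, h₁⟩ := hr
        exact ih.trans ((w.hom.monotone h₀).trans ((hw a).trans (w.hom.monotone h₁)))
    · obtain ⟨b, rfl⟩ := coinserterProj_surjective h x
      exact ConcreteCategory.congr_hom hv b
  monotone v v' hv x := by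
    obtain ⟨b, rfl⟩ := coinserterProj_surjective h x
    exact hv b

end Coinserter

/-! ### Coinserters of algebras and strong finitarity -/

namespace OrdVariety

variable {V : OrdVariety.{u}}

section Coinserter

variable {A B : V.Algebras} {f₀ f₁ : A ⟶ B}
  (h : IsReflexivePair (V.forget.map f₀) (V.forget.map f₁))

/-- Applying `σ` in `A` to the witnesses gives a witness, as both maps are homomorphisms. -/
theorem op_inserterRel {n : ℕ} (σ : V.sig n) {a b : Fin n → B.obj.carrier}
    (hab : ∀ i, InserterRel (V.forget.map f₀) (V.forget.map f₁) (a i) (b i)) :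
    InserterRel (V.forget.map f₀) (V.forget.map f₁) (B.obj.op σ a) (B.obj.op σ b) := by
  choose x h₀ h₁ using hab
  exact ⟨A.obj.op σ x, ((B.obj.op σ).monotone h₀).trans (f₀.hom.map_op σ x).ge,
    (f₁.hom.map_op σ x).le.trans ((B.obj.op σ).monotone h₁)⟩

variable (f₀ f₁) in
/-- The operations on the codomain of a pair of homomorphisms. -/
def preCoinserterOp {n : ℕ} (σ : V.sig n)
    (a : Fin n → PreCoinserter (V.forget.map f₀) (V.forget.map f₁)) :
    PreCoinserter (V.forget.map f₀) (V.forget.map f₁) :=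
  B.obj.op σ a

include h in
theorem preCoinserterOp_monotone {n : ℕ} (σ : V.sig n) : Monotone (preCoinserterOp f₀ f₁ σ) :=
  fun a b hab => Relation.ReflTransGen.lift (B.obj.op σ) (fun _ _ => op_inserterRel σ) a b
    (reflTransGen_pi (fun _ => h.inserterRel_of_le le_rfl) hab)

/-- The ordered algebra on the coinserter of a reflexive pair of homomorphisms. -/
noncomputable def coinserterOrdAlg : OrdAlg V.sig :=
  OrdAlg.quotient (B := PreCoinserter (V.forget.map f₀) (V.forget.map f₁))
    (preCoinserterOp f₀ f₁) (preCoinserterOp_monotone h)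

/-- The coinserter of a reflexive pair of homomorphisms, as a homomorphism. -/
noncomputable def coinserterOrdAlgProj : B.obj ⟶ coinserterOrdAlg h where
  map := coinserterProj h
  map_op σ a := (OrdAlg.quotient_op (B := PreCoinserter (V.forget.map f₀) (V.forget.map f₁))
    (preCoinserterOp f₀ f₁) (preCoinserterOp_monotone h) σ a).symm

/-- The coinserter of a reflexive pair of homomorphisms in a variety. -/
noncomputable def coinserterAlg : V.Algebras :=
  ⟨coinserterOrdAlg h, mem_of_surjective (coinserterOrdAlgProj h) (coinserterProj_surjective h)⟩

theorem exists_coinserterAlg_desc {D : V.Algebras} (w : B ⟶ D)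
    (hw : (V.forget.map f₀ ≫ V.forget.map w).hom ≤ (V.forget.map f₁ ≫ V.forget.map w).hom) :
    ∃ v : coinserterAlg h ⟶ D, coinserterProj h ≫ V.forget.map v = V.forget.map w := by
  obtain ⟨v, hv, -⟩ := (coinserterProj_isCoinserter h).existsUnique (V.forget.map w) hw
  refine ⟨ObjectProperty.homMk ⟨v, fun {n} σ a => ?_⟩, hv⟩
  choose b hb using fun i => coinserterProj_surjective h (a i)
  obtain rfl : (fun i => coinserterProj h (b i)) = a := funext hb
  refine (congrArg v ((coinserterOrdAlgProj h).map_op σ b).symm).trans ?_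
  have hv' : ∀ x, v (coinserterProj h x) = w.hom.map x := ConcreteCategory.congr_hom hv
  refine (hv' _).trans ((w.hom.map_op σ b).trans ?_)
  congr 1
  funext i
  exact (hv' _).symm

end Coinserter

variable {L : PartOrd.{u} ⥤ V.Algebras} (adj : L ⊣ V.forget)

include adj in
theorem free_map_le {X Y : PartOrd.{u}} {f g : X ⟶ Y} (h : f.hom ≤ g.hom) :
    (V.forget.map (L.map f)).hom ≤ (V.forget.map (L.map g)).hom :=
  hom_le_of_gen adj fun x => by
    rw [map_gen, map_gen]
    exact (adj.unit.app Y).hom.monotone (h x)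

include adj in
-- The coinserter of the pair of free homomorphisms, formed on posets, is an algebra of the variety.
-- It is isomorphic to `L.obj C`: `v` comes from its own universal property, and the inverse `l`
-- from those of `c` and of the free algebra.
theorem free_map_isCoinserter {A B C : PartOrd.{u}} {f₀ f₁ : A ⟶ B} {c : B ⟶ C}
    (hr : IsReflexivePair f₀ f₁) (hc : IsCoinserter f₀ f₁ c) :
    IsCoinserter (V.forget.map (L.map f₀)) (V.forget.map (L.map f₁))
      (V.forget.map (L.map c)) := by
  have h : IsReflexivePair (V.forget.map (L.map f₀)) (V.forget.map (L.map f₁)) := by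
    obtain ⟨i, h₀, h₁⟩ := hr
    exact ⟨V.forget.map (L.map i), by rw [← V.forget.map_comp, ← L.map_comp, h₀]; simp,
      by rw [← V.forget.map_comp, ← L.map_comp, h₁]; simp⟩
  let p : L.obj B ⟶ coinserterAlg h := ObjectProperty.homMk (coinserterOrdAlgProj h)
  obtain ⟨v, hv⟩ := exists_coinserterAlg_desc h (L.map c) (by
    rw [← V.forget.map_comp, ← V.forget.map_comp, ← L.map_comp, ← L.map_comp]
    exact free_map_le adj hc.condition)
  obtain ⟨g, hg, -⟩ := hc.existsUnique (D := V.forget.obj (coinserterAlg h))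
    (adj.unit.app B ≫ V.forget.map p) (fun a => by
      have := (coinserterProj_isCoinserter h).condition (gen adj a)
      change p.hom.map ((L.map f₀).hom.map (gen adj a)) ≤
        p.hom.map ((L.map f₁).hom.map (gen adj a)) at this
      rw [map_gen, map_gen] at this
      exact this)
  let l : L.obj C ⟶ coinserterAlg h := lift adj g
  have hl : ∀ x, l.hom.map (gen adj x) = g x := lift_gen adj _
  have hp : L.map c ≫ l = p := hom_ext_gen adj fun b => by
    change l.hom.map ((L.map c).hom.map (gen adj b)) = _
    rw [map_gen, hl]
    exact ConcreteCategory.congr_hom hg b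
  have hv' : p ≫ v = L.map c := ObjectProperty.hom_ext _ (OrdAlg.Hom.ext hv)
  have e₁ : v ≫ l = 𝟙 _ := by
    apply ObjectProperty.hom_ext
    apply OrdAlg.Hom.ext
    refine PartOrd.ext fun x => ?_
    obtain ⟨b, rfl⟩ := coinserterProj_surjective h x
    have : p ≫ v ≫ l = p := by rw [reassoc_of% hv', hp]
    exact ConcreteCategory.congr_hom (congrArg (fun k => V.forget.map k) this) b
  have e₂ : l ≫ v = 𝟙 _ := by
    apply (adj.homEquiv _ _).injective
    rw [adj.homEquiv_unit, adj.homEquiv_unit]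
    apply hc.hom_ext
    have : ∀ k : L.obj C ⟶ L.obj C, c ≫ adj.unit.app C ≫ V.forget.map k =
        adj.unit.app B ≫ V.forget.map (L.map c ≫ k) := fun k => by
      rw [V.forget.map_comp]
      exact (adj.unit.naturality_assoc c _)
    rw [this, this, reassoc_of% hp, hv', Category.comp_id]
  exact (coinserterProj_isCoinserter h).of_iso
    (V.forget.mapIso ⟨v, l, e₁, e₂⟩) hv

theorem toMonad_isStronglyFinitary : isStronglyFinitaryMonad adj.toMonad where
  locallyMonotone _ _ h := free_map_le adj h
  finitary := toMonad_preservesFilteredColimits adj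
  map_isCoinserter _ _ _ := free_map_isCoinserter adj

end OrdVariety

/-! ### Monad morphisms and lifts to Eilenberg-Moore algebras -/

section MonadHom

universe v₁ v₂ u₁ u₂

variable {C : Type u₁} [Category.{v₁} C] {D : Type u₂} [Category.{v₂} D]

/-- A natural family of algebra structures of the monad `S` on the values of the functor `R`. -/
@[ext]
structure AlgebraStructure (S : Monad C) (R : D ⥤ C) where
  a (A : D) : S.obj (R.obj A) ⟶ R.obj A
  nat {A B : D} (f : A ⟶ B) : S.map (R.map f) ≫ a B = a A ≫ R.map f
  unit (A : D) : S.η.app (R.obj A) ≫ a A = 𝟙 (R.obj A)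
  assoc (A : D) : S.μ.app (R.obj A) ≫ a A = S.map (a A) ≫ a A

namespace AlgebraStructure

variable {S : Monad C} {R : D ⥤ C} (α : AlgebraStructure S R)

/-- The functor to the algebras of a monad given by a natural family of algebra structures. -/
def toFunctor : D ⥤ S.Algebra where
  obj A := { A := R.obj A, a := α.a A, unit := α.unit A, assoc := α.assoc A }
  map f := { f := R.map f, h := α.nat f }

theorem exists_eq_toFunctor (G : D ⥤ S.Algebra) (h : G ⋙ S.forget = R) :
    ∃ α : AlgebraStructure S R, G = α.toFunctor := by
  subst h
  exact ⟨{ a := fun A => (G.obj A).a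
           nat := fun f => (G.map f).h
           unit := fun A => (G.obj A).unit
           assoc := fun A => (G.obj A).assoc }, rfl⟩

theorem toFunctor_injective {α β : AlgebraStructure S R} (h : α.toFunctor = β.toFunctor) :
    α.a = β.a := by
  funext A
  have := Functor.congr_obj h A
  injection this

variable {L : C ⥤ D} (adj : L ⊣ R)

/-- Naturality at the counit and a triangle identity: the structures on free objects determine all
others. -/
theorem map_unit_a_map_counit (A : D) :
    S.map (adj.unit.app (R.obj A)) ≫ α.a (L.obj (R.obj A)) ≫ R.map (adj.counit.app A) =
      α.a A := by
  rw [← α.nat, ← S.map_comp_assoc, adj.right_triangle_components]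
  exact (congrArg (· ≫ α.a A) (S.map_id _)).trans (Category.id_comp _)

/-- The monad morphism that corresponds to a natural family of algebra structures. -/
def toMonadHom : S ⟶ adj.toMonad where
  app X := S.map (adj.unit.app X) ≫ α.a (L.obj X)
  naturality X Y f := by
    have h : S.map f ≫ S.map (adj.unit.app Y) ≫ α.a (L.obj Y) =
        (S.map (adj.unit.app X) ≫ α.a (L.obj X)) ≫ R.map (L.map f) := by
      have h₁ : f ≫ adj.unit.app Y = adj.unit.app X ≫ R.map (L.map f) := adj.unit.naturality f
      rw [Category.assoc, ← α.nat, ← S.map_comp_assoc, ← S.map_comp_assoc, h₁]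
    exact h
  app_η X := by
    have h : S.η.app X ≫ S.map (adj.unit.app X) ≫ α.a (L.obj X) = adj.unit.app X := by
      have h₁ : adj.unit.app X ≫ S.η.app (R.obj (L.obj X)) =
        S.η.app X ≫ S.map (adj.unit.app X) := S.η.naturality (adj.unit.app X)
      rw [← reassoc_of% h₁, α.unit]
      exact Category.comp_id _
    exact h
  app_μ X := by
    have h : S.μ.app X ≫ S.map (adj.unit.app X) ≫ α.a (L.obj X) =
        (S.map (S.map (adj.unit.app X) ≫ α.a (L.obj X)) ≫
          S.map (adj.unit.app (R.obj (L.obj X))) ≫ α.a (L.obj (R.obj (L.obj X)))) ≫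
        R.map (adj.counit.app (L.obj X)) := by
      have h₁ : S.map (S.map (adj.unit.app X)) ≫ S.μ.app (R.obj (L.obj X)) =
        S.μ.app X ≫ S.map (adj.unit.app X) := S.μ.naturality (adj.unit.app X)
      rw [← reassoc_of% h₁, α.assoc, Category.assoc, Category.assoc,
        α.map_unit_a_map_counit adj, S.map_comp_assoc]
    exact h

/-- The algebra structures that a monad morphism into the monad of an adjunction induces. -/
def ofMonadHom (ρ : S ⟶ adj.toMonad) : AlgebraStructure S R where
  a A := ρ.app (R.obj A) ≫ R.map (adj.counit.app A)
  nat f := ((Monad.comparison adj ⋙ Monad.algebraFunctorOfMonadHom ρ).map f).h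
  unit A := ((Monad.comparison adj ⋙ Monad.algebraFunctorOfMonadHom ρ).obj A).unit
  assoc A := ((Monad.comparison adj ⋙ Monad.algebraFunctorOfMonadHom ρ).obj A).assoc

theorem ofMonadHom_toFunctor (ρ : S ⟶ adj.toMonad) :
    (ofMonadHom adj ρ).toFunctor = Monad.comparison adj ⋙ Monad.algebraFunctorOfMonadHom ρ :=
  rfl

theorem ofMonadHom_toMonadHom : ofMonadHom adj (α.toMonadHom adj) = α := by
  ext A
  refine Eq.trans ?_ (α.map_unit_a_map_counit adj A)
  exact Category.assoc _ _ _

/-- Naturality of `ρ` at the unit, with the other triangle identity, recovers `ρ` from its algebra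
structures. -/
theorem app_eq_of_ofMonadHom (ρ : S ⟶ adj.toMonad) (X : C) :
    ρ.app X = S.map (adj.unit.app X) ≫ (ofMonadHom adj ρ).a (L.obj X) := by
  have h : S.map (adj.unit.app X) ≫ ρ.app (R.obj (L.obj X)) =
    ρ.app X ≫ R.map (L.map (adj.unit.app X)) := ρ.naturality (adj.unit.app X)
  change _ = S.map (adj.unit.app X) ≫ ρ.app (R.obj (L.obj X)) ≫ R.map (adj.counit.app (L.obj X))
  refine Eq.trans ?_ (Category.assoc _ _ _)
  refine Eq.trans ?_ (congrArg (· ≫ R.map (adj.counit.app (L.obj X))) h.symm)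
  refine Eq.trans ?_ (Category.assoc _ _ _).symm
  have h' : R.map (L.map (adj.unit.app X)) ≫ R.map (adj.counit.app (L.obj X)) = 𝟙 _ := by
    rw [← R.map_comp]
    exact (congrArg R.map (adj.left_triangle_components X)).trans (R.map_id _)
  exact ((congrArg (ρ.app X ≫ ·) h').trans (Category.comp_id _)).symm

end AlgebraStructure

theorem existsUnique_monadHom {S : Monad C} {R : D ⥤ C} {L : C ⥤ D} (adj : L ⊣ R)
    (G : D ⥤ S.Algebra) (h : G ⋙ S.forget = R) :
    ∃! ρ : S ⟶ adj.toMonad,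
      Monad.comparison adj ⋙ Monad.algebraFunctorOfMonadHom ρ = G := by
  obtain ⟨α, rfl⟩ := AlgebraStructure.exists_eq_toFunctor G h
  refine ⟨α.toMonadHom adj, ?_, fun ρ hρ => ?_⟩
  · change _ = _
    rw [← AlgebraStructure.ofMonadHom_toFunctor, α.ofMonadHom_toMonadHom]
  · have h₁ := AlgebraStructure.toFunctor_injective
      ((AlgebraStructure.ofMonadHom_toFunctor adj ρ).trans hρ)
    apply MonadHom.ext'
    funext X
    rw [AlgebraStructure.app_eq_of_ofMonadHom adj ρ X, h₁]
    rfl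

theorem algebra_mk_eq {S : Monad C} {A : C} {a a' : S.obj A ⟶ A} (h : a = a') {u u' v v'} :
    Monad.Algebra.mk A a u v = Monad.Algebra.mk A a' u' v' := by
  subst h
  rfl

theorem algebra_heq_hom {S : Monad C} {A A' B B' : S.Algebra} (hA : A = A') (hB : B = B')
    {f : A ⟶ B} {g : A' ⟶ B'} (h : HEq f.f g.f) : HEq f g := by
  subst hA hB
  exact heq_of_eq (Monad.Algebra.Hom.ext (eq_of_heq h))

end MonadHom

/-! ### The comparison functor is an isomorphism of categories -/

namespace OrdVariety

variable {V : OrdVariety.{u}} {L : PartOrd.{u} ⥤ V.Algebras} (adj : L ⊣ V.forget)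

/-- The structure map of an algebra in a variety. -/
def str (A : V.Algebras) : (L.obj A.obj.carrier).obj.carrier → A.obj.carrier :=
  V.forget.map (adj.counit.app A)

theorem str_gen (A : V.Algebras) (x : A.obj.carrier) : str adj A (gen adj x) = x :=
  ConcreteCategory.congr_hom (adj.right_triangle_components A) x

theorem str_op (A : V.Algebras) {n : ℕ} (σ : V.sig n)
    (t : Fin n → (L.obj A.obj.carrier).obj.carrier) :
    str adj A ((L.obj A.obj.carrier).obj.op σ t) = A.obj.op σ fun i => str adj A (t i) :=
  (adj.counit.app A).hom.map_op σ t

theorem op_eq_str (A : V.Algebras) {n : ℕ} (σ : V.sig n) (a : Fin n → A.obj.carrier) :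
    A.obj.op σ a = str adj A ((L.obj A.obj.carrier).obj.op σ fun i => gen adj (a i)) := by
  rw [str_op]
  simp only [str_gen]

/-- The structure map evaluates `σ` applied to generators, so it determines the operations
(`op_eq_str`). -/
theorem algebras_ext {A B : V.Algebras}
    (h : (Monad.comparison adj).obj A = (Monad.comparison adj).obj B) : A = B := by
  obtain ⟨⟨A, o⟩, hA⟩ := A
  obtain ⟨⟨B, o'⟩, hB⟩ := B
  obtain rfl : A = B := congrArg Monad.Algebra.A h
  have hs : str adj ⟨⟨A, o⟩, hA⟩ = str adj ⟨⟨A, o'⟩, hB⟩ := by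
    injection h with _ h
    exact congrArg (fun f : (V.forget.obj (L.obj A)) ⟶ A => (f : _ → A)) h
  have : @o = @o' := by
    funext n σ
    ext a
    have h₁ := op_eq_str adj ⟨⟨A, o⟩, hA⟩ σ a
    have h₂ := op_eq_str adj ⟨⟨A, o'⟩, hB⟩ σ a
    rw [hs] at h₁
    exact h₁.trans h₂.symm
  subst this
  rfl

section OfAlgebra

variable (X : adj.toMonad.Algebra)

/-- The structure map of an Eilenberg-Moore algebra. -/
def emStr : (L.obj X.A).obj.carrier ⟶ X.A := X.a

theorem emStr_gen (x : X.A) : emStr adj X (gen adj x) = x :=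
  ConcreteCategory.congr_hom X.unit x

theorem emStr_str (t : (L.obj (L.obj X.A).obj.carrier).obj.carrier) :
    emStr adj X (str adj (L.obj X.A) t) = emStr adj X ((L.map (emStr adj X)).hom.map t) :=
  ConcreteCategory.congr_hom X.assoc t

/-- The operations of an Eilenberg-Moore algebra. -/
def emOrdAlg : OrdAlg V.sig where
  carrier := X.A
  op σ :=
    { toFun a := emStr adj X ((L.obj X.A).obj.op σ fun i => gen adj (a i))
      monotone' _ _ h := (emStr adj X).hom.monotone (((L.obj X.A).obj.op σ).monotone
        fun i => (adj.unit.app X.A).hom.monotone (h i)) }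

/-- Associativity of the algebra, evaluated at `σ` applied to the generators `t i` of the free
algebra on the free algebra. -/
theorem emStr_op {n : ℕ} (σ : V.sig n) (t : Fin n → (L.obj X.A).obj.carrier) :
    emStr adj X ((L.obj X.A).obj.op σ t) =
      (emOrdAlg adj X).op σ fun i => emStr adj X (t i) := by
  have h := emStr_str adj X
    ((L.obj (L.obj X.A).obj.carrier).obj.op σ fun i => gen adj (t i))
  rw [str_op, (L.map (emStr adj X)).hom.map_op] at h
  simp only [str_gen] at h
  refine h.trans (congrArg (emStr adj X) ?_)
  congr 1
  funext i
  exact map_gen adj (emStr adj X) (t i)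

/-- The algebra of the variety on an Eilenberg-Moore algebra. -/
def ofEM : V.Algebras where
  obj := emOrdAlg adj X
  property := mem_of_surjective (A := L.obj X.A)
    ({ map := emStr adj X, map_op := emStr_op adj X } : (L.obj X.A).obj ⟶ emOrdAlg adj X)
    fun x => ⟨_, emStr_gen adj X x⟩

theorem str_ofEM : V.forget.map (adj.counit.app (ofEM adj X)) = X.a := by
  let f : L.obj X.A ⟶ ofEM adj X :=
    ObjectProperty.homMk { map := emStr adj X, map_op := emStr_op adj X }
  have : adj.counit.app (ofEM adj X) = f := hom_ext_gen adj (X := X.A) fun x =>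
    (str_gen adj (ofEM adj X) x).trans (emStr_gen adj X x).symm
  exact congrArg (fun k => V.forget.map k) this

theorem comparison_ofEM : (Monad.comparison adj).obj (ofEM adj X) = X :=
  algebra_mk_eq (str_ofEM adj X)

end OfAlgebra

theorem ofEM_map {X Y : adj.toMonad.Algebra} (f : X ⟶ Y) {n : ℕ} (σ : V.sig n)
    (a : Fin n → X.A) : f.f ((emOrdAlg adj X).op σ a) = (emOrdAlg adj Y).op σ fun i => f.f (a i) := by
  have h : ∀ t, emStr adj Y ((L.map f.f).hom.map t) = f.f (emStr adj X t) :=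
    ConcreteCategory.congr_hom f.h
  refine (h _).symm.trans (congrArg (emStr adj Y) ?_)
  refine ((L.map f.f).hom.map_op σ _).trans ?_
  congr 1
  funext i
  exact map_gen adj f.f (a i)

/-- The inverse of the comparison functor. -/
def ofEMFunctor : adj.toMonad.Algebra ⥤ V.Algebras where
  obj := ofEM adj
  map f := ObjectProperty.homMk { map := f.f, map_op := ofEM_map adj f }

theorem ofEMFunctor_comparison : ofEMFunctor adj ⋙ Monad.comparison adj = 𝟭 _ :=
  Functor.hext (comparison_ofEM adj) fun X Y _ =>
    algebra_heq_hom (comparison_ofEM adj X) (comparison_ofEM adj Y) HEq.rfl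

theorem algebras_heq_hom {A A' B B' : V.Algebras} (hA : A = A') (hB : B = B')
    {f : A ⟶ B} {g : A' ⟶ B'} (h : HEq f.hom.map g.hom.map) : HEq f g := by
  subst hA hB
  exact heq_of_eq (ObjectProperty.hom_ext _ (OrdAlg.Hom.ext (eq_of_heq h)))

theorem comparison_ofEMFunctor : Monad.comparison adj ⋙ ofEMFunctor adj = 𝟭 _ :=
  have h (A : V.Algebras) : ofEM adj ((Monad.comparison adj).obj A) = A :=
    algebras_ext adj (comparison_ofEM adj _)
  Functor.hext h fun A B _ => algebras_heq_hom (h A) (h B) HEq.rfl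

end OrdVariety

/-! ### Posets as colimits of finite discrete posets -/

section Discrete

/-- The discrete poset on a type. -/
def discrete (α : Type u) : PartOrd.{u} :=
  @PartOrd.of α
    { le := Eq
      le_refl := Eq.refl
      le_trans := fun _ _ _ => Eq.trans
      le_antisymm := fun _ _ h _ => h }

/-- A map out of a discrete poset. -/
def discreteDesc {α : Type u} {X : PartOrd.{u}} (f : α → X) : discrete α ⟶ X :=
  ConcreteCategory.ofHom (C := PartOrd) (X := discrete α)
    ⟨f, fun x y h => (congrArg f (show x = y from h)).le⟩

/-- Equivalent types have isomorphic discrete posets. -/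
def discreteIso {α β : Type u} (e : α ≃ β) : discrete α ≅ discrete β where
  hom := discreteDesc (X := discrete β) e
  inv := discreteDesc (X := discrete α) e.symm
  hom_inv_id := PartOrd.ext e.symm_apply_apply
  inv_hom_id := PartOrd.ext e.apply_symm_apply

/-- The diagram of the finite subsets of a discrete poset. -/
def finsetDiagram (α : Type u) : Finset α ⥤ PartOrd.{u} where
  obj s := discrete s
  map f := discreteDesc (X := discrete _) fun x => ⟨x.1, leOfHom f x.2⟩

/-- A discrete poset as a cocone over its finite subsets. -/
def finsetCocone (α : Type u) : Cocone (finsetDiagram α) where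
  pt := discrete α
  ι := { app s := discreteDesc (X := discrete α) fun x => x.1 }

/-- A discrete poset is the filtered colimit of its finite subsets. -/
def finsetCoconeIsColimit (α : Type u) : IsColimit (finsetCocone α) where
  desc s := discreteDesc fun x => s.ι.app {x} (⟨x, Finset.mem_singleton_self x⟩ : ({x} : Finset α))
  fac s _ := PartOrd.ext fun x =>
    ConcreteCategory.congr_hom (s.w (homOfLE (Finset.singleton_subset_iff.2 x.2))).symm
      (⟨x.1, Finset.mem_singleton_self x.1⟩ : ({x.1} : Finset α))
  uniq _ _ hm := PartOrd.ext fun x => ConcreteCategory.congr_hom (hm {x})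
    (⟨x, Finset.mem_singleton_self x⟩ : ({x} : Finset α))

theorem discrete_isReflexivePair (P : PartOrd.{u}) :
    IsReflexivePair (discreteDesc (X := discrete P) fun x : {x : P × P // x.1 ≤ x.2} => x.1.1)
      (discreteDesc (X := discrete P) fun x : {x : P × P // x.1 ≤ x.2} => x.1.2) :=
  ⟨discreteDesc (X := discrete _) fun x => ⟨(x, x), le_rfl⟩, rfl, rfl⟩

theorem discrete_isCoinserter (P : PartOrd.{u}) :
    IsCoinserter (discreteDesc (X := discrete P) fun x : {x : P × P // x.1 ≤ x.2} => x.1.1)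
      (discreteDesc (X := discrete P) fun x : {x : P × P // x.1 ≤ x.2} => x.1.2)
      (discreteDesc fun x : P => x) where
  condition x := x.2
  existsUnique {D} w hw := by
    refine ⟨PartOrd.ofHom ⟨fun x => w x, fun x y h => hw ⟨(x, y), h⟩⟩, rfl, fun v hv => ?_⟩
    exact PartOrd.ext fun x => ConcreteCategory.congr_hom hv x
  monotone v v' hv x := hv x

end Discrete

/-! ### Strongly finitary functors are determined on finite discrete posets -/

section Extension

variable {H G : PartOrd.{u} ⥤ PartOrd.{u}}

theorem isIso_app_discrete (hH : PreservesFilteredColimits H) (hG : PreservesFilteredColimits G)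
    (ρ : H ⟶ G) (h : ∀ n : ℕ, IsIso (ρ.app (discrete (ULift.{u} (Fin n))))) (α : Type u) :
    IsIso (ρ.app (discrete α)) := by
  classical
  have hf (s : Finset α) : IsIso (ρ.app (discrete s)) := by
    rw [NatTrans.isIso_app_iff_of_iso ρ (discreteIso (s.equivFin.trans Equiv.ulift.symm))]
    exact h _
  have : IsIso (Functor.whiskerLeft (finsetDiagram α) ρ) := by
    have (s : Finset α) : IsIso ((Functor.whiskerLeft (finsetDiagram α) ρ).app s) := hf s
    exact NatIso.isIso_of_isIso_app _
  let e := IsColimit.coconePointsIsoOfNatIso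
    (isColimitOfPreserves H (finsetCoconeIsColimit α))
    (isColimitOfPreserves G (finsetCoconeIsColimit α))
    (asIso (Functor.whiskerLeft (finsetDiagram α) ρ))
  have he : e.hom = ρ.app (discrete α) :=
    (isColimitOfPreserves H (finsetCoconeIsColimit α)).hom_ext fun s => by
      refine (IsColimit.comp_coconePointsIsoOfNatIso_hom _ _ _ s).trans ?_
      exact (ρ.naturality _).symm
  exact he ▸ e.isIso_hom

theorem IsCoinserter.isIso_of_isIso {A B C A' B' C' : PartOrd.{u}} {f₀ f₁ : A ⟶ B} {c : B ⟶ C}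
    {f₀' f₁' : A' ⟶ B'} {c' : B' ⟶ C'} (h : IsCoinserter f₀ f₁ c) (h' : IsCoinserter f₀' f₁' c')
    {a : A ⟶ A'} {b : B ⟶ B'} {k : C ⟶ C'} [IsIso a] [IsIso b] (h₀ : f₀ ≫ b = a ≫ f₀')
    (h₁ : f₁ ≫ b = a ≫ f₁') (hk : c ≫ k = b ≫ c') : IsIso k := by
  have e₀ : f₀' ≫ inv b = inv a ≫ f₀ := by
    rw [IsIso.comp_inv_eq, Category.assoc, h₀, IsIso.inv_hom_id_assoc]
  have e₁ : f₁' ≫ inv b = inv a ≫ f₁ := by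
    rw [IsIso.comp_inv_eq, Category.assoc, h₁, IsIso.inv_hom_id_assoc]
  obtain ⟨l, hl, -⟩ := h'.existsUnique (inv b ≫ c) (by
    rw [reassoc_of% e₀, reassoc_of% e₁]
    exact fun x => h.condition (inv a x))
  refine ⟨l, h.hom_ext ?_, h'.hom_ext ?_⟩
  · rw [reassoc_of% hk, hl]
    simp
  · rw [reassoc_of% hl, hk]
    simp

theorem IsStronglyFinitary.isIso (hH : IsStronglyFinitary H) (hG : IsStronglyFinitary G)
    (ρ : H ⟶ G) (h : ∀ n : ℕ, IsIso (ρ.app (discrete (ULift.{u} (Fin n))))) : IsIso ρ := by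
  have hd := isIso_app_discrete hH.finitary hG.finitary ρ h
  have (P : PartOrd.{u}) : IsIso (ρ.app P) :=
    have := hd P
    have := hd {x : P × P // x.1 ≤ x.2}
    (hH.map_isCoinserter _ _ _ (discrete_isReflexivePair P)
      (discrete_isCoinserter P)).isIso_of_isIso
      (hG.map_isCoinserter _ _ _ (discrete_isReflexivePair P) (discrete_isCoinserter P))
      (ρ.naturality _) (ρ.naturality _) (ρ.naturality _)
  exact NatIso.isIso_of_isIso_app ρ

end Extension

/-! ### The variety of a strongly finitary monad -/

section MonadVariety

variable (T : Monad PartOrd.{u})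

/-- The signature of a monad: the `n`-ary symbols are the elements of the value of the monad at
the discrete poset with `n` elements. -/
def monadSignature : Signature.{u} := fun n => T.obj (discrete (ULift.{u} (Fin n)))

/-- The map out of the discrete poset with `n` elements that corresponds to an `n`-tuple. -/
def tuple {X : PartOrd.{u}} {n : ℕ} (x : Fin n → X) : discrete (ULift.{u} (Fin n)) ⟶ X :=
  discreteDesc fun i => x i.down

variable {T} (hT : isStronglyFinitaryMonad T)

/-- The operations on an algebra of a monad. -/
def monadOrdAlg (X : T.Algebra) : OrdAlg (monadSignature T) where
  carrier := X.A
  op σ :=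
    { toFun x := X.a (T.map (tuple x) σ)
      monotone' x y h := X.a.hom.monotone (hT.locallyMonotone (tuple x) (tuple y)
        (fun i => h (ULift.down i)) σ) }

/-- The variety of a strongly finitary monad. -/
def monadVariety : OrdVariety.{u} where
  sig := monadSignature T
  mem A := ∀ p : Term (monadSignature T) × Term (monadSignature T),
    (∀ X : T.Algebra, (monadOrdAlg hT X).Satisfies p) → A.Satisfies p
  presentable := ⟨{p | ∀ X : T.Algebra, (monadOrdAlg hT X).Satisfies p}, fun _ => Iff.rfl⟩

/-- The functor from the algebras of a strongly finitary monad to its variety. -/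
def monadAlgebraFunctor : T.Algebra ⥤ (monadVariety hT).Algebras where
  obj X := ⟨monadOrdAlg hT X, fun _ h => h X⟩
  map {X Y} f := ObjectProperty.homMk
    { map := f.f
      map_op σ x := by
        have h : T.map (tuple x) ≫ T.map f.f = T.map (tuple fun i => f.f (x i)) :=
          (T.map_comp _ _).symm
        refine (ConcreteCategory.congr_hom f.h (T.map (tuple x) σ)).symm.trans ?_
        exact congrArg Y.a (ConcreteCategory.congr_hom h σ) }

variable {L : PartOrd.{u} ⥤ (monadVariety hT).Algebras} (adj : L ⊣ (monadVariety hT).forget)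

/-- The homomorphism from the free algebra of the variety of a monad to the free algebra of the
monad. -/
def toFreeMonadAlgebra (X : PartOrd.{u}) : L.obj X ⟶ (monadAlgebraFunctor hT).obj (T.free.obj X) :=
  OrdVariety.lift adj (A := (monadAlgebraFunctor hT).obj (T.free.obj X)) (T.η.app X)

theorem toFreeMonadAlgebra_gen (X : PartOrd.{u}) (x : X) :
    (toFreeMonadAlgebra hT adj X).hom.map (OrdVariety.gen adj x) = T.η.app X x :=
  OrdVariety.lift_gen adj (A := (monadAlgebraFunctor hT).obj (T.free.obj X)) (T.η.app X) x

/-- The symbol `σ`, applied to the generators, is sent to the element `σ` by the unit law of `T`. -/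
theorem toFreeMonadAlgebra_surjective (n : ℕ) : Function.Surjective
    (toFreeMonadAlgebra hT adj (discrete (ULift.{u} (Fin n)))).hom.map := by
  intro σ
  refine ⟨(L.obj _).obj.op (show (monadVariety hT).sig n from σ)
    fun i => OrdVariety.gen adj (X := discrete (ULift.{u} (Fin n))) ⟨i⟩, ?_⟩
  refine ((toFreeMonadAlgebra hT adj _).hom.map_op _ _).trans ?_
  rw [funext fun i : Fin n => toFreeMonadAlgebra_gen hT adj (discrete (ULift.{u} (Fin n))) ⟨i⟩]
  exact ConcreteCategory.congr_hom (T.right_unit (discrete (ULift.{u} (Fin n)))) σ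

theorem lift_eq_toFreeMonadAlgebra (X : PartOrd.{u}) (A : T.Algebra) (x : X ⟶ A.A) :
    OrdVariety.lift adj (A := (monadAlgebraFunctor hT).obj A) x =
      toFreeMonadAlgebra hT adj X ≫
        (monadAlgebraFunctor hT).map ((T.adj.homEquiv X A).symm x) := by
  refine OrdVariety.hom_ext_gen adj fun y => ?_
  refine (OrdVariety.lift_gen adj (A := (monadAlgebraFunctor hT).obj A) x y).trans ?_
  refine Eq.trans ?_ (congrArg ((T.adj.homEquiv X A).symm x).f
    (toFreeMonadAlgebra_gen hT adj X y).symm)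
  exact (ConcreteCategory.congr_hom ((T.adj.homEquiv X A).apply_symm_apply x) y).symm

/-- An inequality in the free `T`-algebra on `n` holds under every interpretation in every
`T`-algebra. It is thus an inequation imposed on the variety, and so holds in its free algebra. -/
theorem toFreeMonadAlgebra_le (n : ℕ) {y z : (L.obj (discrete (ULift.{u} (Fin n)))).obj.carrier}
    (h : (toFreeMonadAlgebra hT adj _).hom.map y ≤ (toFreeMonadAlgebra hT adj _).hom.map z) :
    y ≤ z := by
  -- Generators interpret the first `n` variables; `y` is an arbitrary default for the rest, which
  -- the terms in `hterm` do not use.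
  let f : ℕ → (L.obj (discrete (ULift.{u} (Fin n)))).obj.carrier := fun k =>
    if hk : k < n then OrdVariety.gen adj (X := discrete (ULift.{u} (Fin n))) ⟨⟨k, hk⟩⟩ else y
  have hterm : ∀ w : (L.obj (discrete (ULift.{u} (Fin n)))).obj.carrier,
      ∃ t : Term (monadSignature T), (∀ (A : OrdAlg (monadSignature T)) (g g' : ℕ → A.carrier),
        (∀ k < n, g k = g' k) → t.eval A g = t.eval A g') ∧ t.eval _ f = w := by
    refine OrdVariety.gen_induction adj (fun x => ?_) (fun σ a ih => ?_)
    · obtain ⟨⟨k, hk⟩⟩ := x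
      exact ⟨.var k, fun A g g' h => h k hk, dif_pos hk⟩
    · choose t ht hf using ih
      exact ⟨.op σ t, fun A g g' h => congrArg (A.op σ) (funext fun i => ht i A g g' h),
        congrArg ((L.obj _).obj.op σ) (funext hf)⟩
  obtain ⟨t, ht, hty⟩ := hterm y
  obtain ⟨s, hs, hsz⟩ := hterm z
  have hE : ∀ X : T.Algebra, (monadOrdAlg hT X).Satisfies (t, s) := by
    intro X g
    let φ : L.obj (discrete (ULift.{u} (Fin n))) ⟶ (monadAlgebraFunctor hT).obj X :=
      OrdVariety.lift adj (A := (monadAlgebraFunctor hT).obj X)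
        (tuple (X := X.A) fun i : Fin n => g i)
    have hφ : ∀ k < n, g k = φ.hom.map (f k) := fun k hk => by
      simp only [f, dif_pos hk]
      exact (OrdVariety.lift_gen adj (A := (monadAlgebraFunctor hT).obj X)
        (tuple (X := X.A) fun i : Fin n => g i) ⟨⟨k, hk⟩⟩).symm
    have hφ' : φ = _ := lift_eq_toFreeMonadAlgebra hT adj _ X _
    have ey : t.eval (monadOrdAlg hT X) g = φ.hom.map y :=
      (ht _ _ _ hφ).trans ((φ.hom.map_eval f t).symm.trans (congrArg φ.hom.map hty))
    have ez : s.eval (monadOrdAlg hT X) g = φ.hom.map z :=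
      (hs _ _ _ hφ).trans ((φ.hom.map_eval f s).symm.trans (congrArg φ.hom.map hsz))
    refine ey.trans_le (le_trans ?_ ez.ge)
    -- The interpretation factors through `toFreeMonadAlgebra`, where the inequality is assumed.
    rw [hφ']
    exact ((monadAlgebraFunctor hT).map ((T.adj.homEquiv _ X).symm
      (tuple (X := X.A) fun i : Fin n => g i))).hom.map.hom.monotone h
  have := (L.obj (discrete (ULift.{u} (Fin n)))).property (t, s) hE f
  exact hty.symm.trans_le (this.trans_eq hsz)

theorem isIso_of_surjective_of_le {X Y : PartOrd.{u}} (f : X ⟶ Y) (hs : Function.Surjective f)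
    (hle : ∀ x y, f x ≤ f y → x ≤ y) : IsIso f := by
  let e : X ≃o Y :=
    { Equiv.ofBijective f
        ⟨fun x y h => le_antisymm (hle x y h.le) (hle y x h.ge), hs⟩ with
      map_rel_iff' := ⟨hle _ _, fun h => f.hom.monotone h⟩ }
  exact (PartOrd.Iso.mk e).isIso_hom

/-- The algebra structures of the free-algebra monad of the variety of a monad. -/
def monadVarietyStructure : AlgebraStructure adj.toMonad T.forget where
  a A := (monadVariety hT).forget.map (adj.counit.app ((monadAlgebraFunctor hT).obj A))
  nat f := ((Monad.comparison adj).map ((monadAlgebraFunctor hT).map f)).h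
  unit A := ((Monad.comparison adj).obj ((monadAlgebraFunctor hT).obj A)).unit
  assoc A := ((Monad.comparison adj).obj ((monadAlgebraFunctor hT).obj A)).assoc

theorem monadVariety_toMonad_iso : Nonempty (adj.toMonad ≅ T) := by
  let ρ : adj.toMonad ⟶ T := (monadVarietyStructure hT adj).toMonadHom T.adj ≫ (Adjunction.adjToMonadIso T).hom
  have hρ (X : PartOrd.{u}) :
      ρ.app X = (monadVariety hT).forget.map (toFreeMonadAlgebra hT adj X) := by
    refine (Category.comp_id _).trans ?_
    refine ((monadVariety hT).forget.map_comp _ _).symm.trans ?_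
    exact congrArg (fun k => (monadVariety hT).forget.map k) (adj.homEquiv_counit _ _ _).symm
  have : IsIso ρ.toNatTrans := (OrdVariety.toMonad_isStronglyFinitary adj).isIso hT _ fun n => by
    have := isIso_of_surjective_of_le
      ((monadVariety hT).forget.map (toFreeMonadAlgebra hT adj (discrete (ULift.{u} (Fin n)))))
      (toFreeMonadAlgebra_surjective hT adj n) fun _ _ => toFreeMonadAlgebra_le hT adj n
    exact (hρ _).symm ▸ this
  exact ⟨MonadIso.mk (asIso ρ.toNatTrans) ρ.app_η ρ.app_μ⟩

end MonadVariety

/-! ### Functoriality and the equivalence -/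

section MonadHom

universe v₁ u₁

variable {C : Type u₁} [Category.{v₁} C]

theorem algebraFunctorOfMonadHom_id (T : Monad C) :
    Monad.algebraFunctorOfMonadHom (𝟙 T) = 𝟭 T.Algebra :=
  have h (A : T.Algebra) : (Monad.algebraFunctorOfMonadHom (𝟙 T)).obj A = A :=
    algebra_mk_eq (Category.id_comp A.a)
  Functor.hext h fun A B _ => algebra_heq_hom (h A) (h B) HEq.rfl

theorem algebraFunctorOfMonadHom_comp {T₁ T₂ T₃ : Monad C} (f : T₁ ⟶ T₂) (g : T₂ ⟶ T₃) :
    Monad.algebraFunctorOfMonadHom (f ≫ g) =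
      Monad.algebraFunctorOfMonadHom g ⋙ Monad.algebraFunctorOfMonadHom f :=
  have h (A : T₃.Algebra) : (Monad.algebraFunctorOfMonadHom (f ≫ g)).obj A =
      (Monad.algebraFunctorOfMonadHom g ⋙ Monad.algebraFunctorOfMonadHom f).obj A :=
    algebra_mk_eq (Category.assoc (f.app A.A) (g.app A.A) A.a)
  Functor.hext h fun A B _ => algebra_heq_hom (h A) (h B) HEq.rfl

end MonadHom

namespace OrdVariety

variable (L : ∀ V : OrdVariety.{u}, PartOrd.{u} ⥤ V.Algebras) (adj : ∀ V, L V ⊣ V.forget)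

theorem existsUnique_monadHom_of_concreteFunctor {V W : OrdVariety.{u}} (F : V ⟶ W) :
    ∃! ρ : (adj W).toMonad ⟶ (adj V).toMonad,
      Monad.comparison (adj V) ⋙ Monad.algebraFunctorOfMonadHom ρ =
        F.functor ⋙ Monad.comparison (adj W) :=
  existsUnique_monadHom (adj V) (F.functor ⋙ Monad.comparison (adj W)) F.comp_forget

/-- The monad morphism that induces a concrete functor between varieties. -/
noncomputable def monadHom {V W : OrdVariety.{u}} (F : V ⟶ W) :
    (adj W).toMonad ⟶ (adj V).toMonad :=
  (existsUnique_monadHom_of_concreteFunctor L adj F).choose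

theorem comparison_monadHom {V W : OrdVariety.{u}} (F : V ⟶ W) :
    Monad.comparison (adj V) ⋙ Monad.algebraFunctorOfMonadHom (monadHom L adj F) =
      F.functor ⋙ Monad.comparison (adj W) :=
  (existsUnique_monadHom_of_concreteFunctor L adj F).choose_spec.1

theorem monadHom_unique {V W : OrdVariety.{u}} (F : V ⟶ W)
    {ρ : (adj W).toMonad ⟶ (adj V).toMonad}
    (h : Monad.comparison (adj V) ⋙ Monad.algebraFunctorOfMonadHom ρ =
      F.functor ⋙ Monad.comparison (adj W)) : monadHom L adj F = ρ :=
  ((existsUnique_monadHom_of_concreteFunctor L adj F).choose_spec.2 ρ h).symm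

theorem monadHom_id (V : OrdVariety.{u}) : monadHom L adj (𝟙 V) = 𝟙 (adj V).toMonad :=
  monadHom_unique L adj (𝟙 V)
    (congrArg (Monad.comparison (adj V) ⋙ ·) (algebraFunctorOfMonadHom_id _))

theorem monadHom_comp {V W Z : OrdVariety.{u}} (F : V ⟶ W) (G : W ⟶ Z) :
    monadHom L adj (F ≫ G) = monadHom L adj G ≫ monadHom L adj F := by
  apply monadHom_unique
  calc
    _ = (Monad.comparison (adj V) ⋙ Monad.algebraFunctorOfMonadHom (monadHom L adj F)) ⋙
        Monad.algebraFunctorOfMonadHom (monadHom L adj G) :=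
      congrArg (Monad.comparison (adj V) ⋙ ·) (algebraFunctorOfMonadHom_comp _ _)
    _ = F.functor ⋙ Monad.comparison (adj W) ⋙
        Monad.algebraFunctorOfMonadHom (monadHom L adj G) := by
      rw [comparison_monadHom, Functor.assoc]
    _ = F.functor ⋙ G.functor ⋙ Monad.comparison (adj Z) := by rw [comparison_monadHom]

/-- The functor that sends a variety to its free-algebra monad. -/
noncomputable def monadFunctor : OrdVariety.{u} ⥤ StronglyFinitaryMonad.{u}ᵒᵖ where
  obj V := op ⟨(adj V).toMonad, toMonad_isStronglyFinitary (adj V)⟩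
  map F := (ObjectProperty.homMk (P := isStronglyFinitaryMonad) (X := ⟨_, _⟩) (Y := ⟨_, _⟩)
    (monadHom L adj F)).op
  map_id V := congrArg Quiver.Hom.op (ObjectProperty.hom_ext _ (monadHom_id L adj V))
  map_comp F G := congrArg Quiver.Hom.op (ObjectProperty.hom_ext _ (monadHom_comp L adj F G))

theorem concreteFunctor_ext {V W : OrdVariety.{u}} {F G : V ⟶ W}
    (h : F.functor ⋙ Monad.comparison (adj W) = G.functor ⋙ Monad.comparison (adj W)) :
    F = G := by
  apply ConcreteFunctor.ext
  have := congrArg (· ⋙ ofEMFunctor (adj W)) h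
  rwa [Functor.assoc, Functor.assoc, comparison_ofEMFunctor] at this

instance : (monadFunctor L adj).Faithful where
  map_injective {V W} F G h := concreteFunctor_ext L adj <| by
    have h' : monadHom L adj F = monadHom L adj G :=
      congrArg (fun k => InducedCategory.Hom.hom (Quiver.Hom.unop k)) h
    rw [← comparison_monadHom, ← comparison_monadHom, h']

instance : (monadFunctor L adj).Full where
  map_surjective {V W} ρ := by
    let F : V ⟶ W :=
      { functor := Monad.comparison (adj V) ⋙ Monad.algebraFunctorOfMonadHom ρ.unop.hom ⋙
          ofEMFunctor (adj W)
        -- None of the three functors changes underlying posets or maps.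
        comp_forget := rfl }
    refine ⟨F, congrArg Quiver.Hom.op (ObjectProperty.hom_ext _ (monadHom_unique L adj F ?_))⟩
    exact congrArg (fun k => Monad.comparison (adj V) ⋙
      Monad.algebraFunctorOfMonadHom ρ.unop.hom ⋙ k) (ofEMFunctor_comparison (adj W)).symm

instance : (monadFunctor L adj).EssSurj where
  mem_essImage T := by
    obtain ⟨e⟩ := monadVariety_toMonad_iso T.unop.property (adj (monadVariety T.unop.property))
    exact ⟨monadVariety T.unop.property, ⟨(ObjectProperty.isoMk _ e.symm).op⟩⟩

instance : (monadFunctor L adj).IsEquivalence where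

end OrdVariety

end OrderedAlgebra

theorem mainTheorem1 :
    -- every variety has free algebras on all posets
    (∀ V : OrderedAlgebra.OrdVariety.{u}, V.forget.IsRightAdjoint) ∧
    -- for every choice of the free-algebra functors
    ∀ (L : ∀ V : OrderedAlgebra.OrdVariety.{u}, PartOrd.{u} ⥤ V.Algebras)
      (adj : ∀ V : OrderedAlgebra.OrdVariety.{u}, L V ⊣ V.forget),
      -- the free-algebra monads are strongly finitary
      ∃ (sf : ∀ V : OrderedAlgebra.OrdVariety.{u},
          OrderedAlgebra.isStronglyFinitaryMonad (adj V).toMonad)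
        -- and there is a dual equivalence of categories
        (e : OrderedAlgebra.OrdVariety.{u} ≌ OrderedAlgebra.StronglyFinitaryMonad.{u}ᵒᵖ)
        -- that sends every variety to its free-algebra monad
        (φ : ∀ V : OrderedAlgebra.OrdVariety.{u}, (e.functor.obj V).unop ≅ ⟨(adj V).toMonad, sf V⟩),
        -- and every concrete functor to the monad morphism that induces it on algebras
        ∀ {V W : OrderedAlgebra.OrdVariety.{u}} (F : V ⟶ W),
          Monad.comparison (adj V) ⋙ Monad.algebraFunctorOfMonadHom
              ((φ W).inv ≫ (e.functor.map F).unop ≫ (φ V).hom).hom =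
            F.functor ⋙ Monad.comparison (adj W) := by
  refine ⟨fun V => V.forget_isRightAdjoint, fun L adj =>
    ⟨fun V => OrderedAlgebra.OrdVariety.toMonad_isStronglyFinitary (adj V),
      (OrderedAlgebra.OrdVariety.monadFunctor L adj).asEquivalence,
      fun V => Iso.refl _, fun {V W} F => ?_⟩⟩
  -- The isomorphisms `φ` are identities, so only the monad morphism chosen for `F` remains.
  refine Eq.trans ?_ (OrderedAlgebra.OrdVariety.comparison_monadHom L adj F)
  refine congrArg (fun ρ => Monad.comparison (adj V) ⋙ Monad.algebraFunctorOfMonadHom ρ) ?_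
  exact (Category.id_comp _).trans (Category.comp_id _)
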